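/- Let $S^1=\mathbf R/\mathbf Z$, let $\pi:\mathbf R\to S^1$ be the projection, let $I=[0,1)$ with Lebesgue measure $\nu_0$, and let $L^2_{\mathbf Z}(I)\subset L^2(I)=L^2(I,\mathbf R)$ be the subgroup of integer-valued functions; put $\mathbf T=L^2(I)/L^2_{\mathbf Z}(I)$. Let $V\in C^2(S^1\times S^1)$ and $W\in C^2(S^1)$ be real-valued, where $W$ is even, $W\le 0$, $W(x)=0$ if and only if $x\in\mathbf Z$, and $W''(x)<0$ for $x\in\mathbf Z$. For $c\in\mathbf R$, $t,p\in\mathbf R$, $q\in S^1$ and $M,N\in L^2(I)$ let $$L_c(t,q,p)=\tfrac12|p|^2-V(t,q)-c\,p,$$ $$\mathcal L_c(t,M,N)=\tfrac12\|N\|_{L^2(I)}^2-\int_I V(t,M(z))\,dz-\mathcal W(M)-\int_I c\,N(z)\,dz,\qquad \mathcal W(M)=\tfrac12\int_{I\times I}W(M(z)-M(z'))\,dz\,dz'.$$ *Absolute continuity and minimality.* A curve $\sigma$ in $L^2(I)$ (or in $\mathbf R$) is absolutely continuous (AC) on an interval $K$ if it is a primitive on $K$ of some $\dot\sigma\in L^1_{loc}(K)$;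 a curve in $S^1$ is AC if it has an AC lift to $\mathbf R$. An action integral is $+\infty$ when its integrand is not integrable. An AC curve $\sigma:\mathbf R\to L^2(I)$ is $c$-minimal for $\mathcal L$ if, for all $t_0<t_1$ and every AC curve $\tilde\sigma:[t_0,t_1]\to L^2(I)$ with $\tilde\sigma_{t_i}-\sigma_{t_i}\in L^2_{\mathbf Z}(I)$ for $i=0,1$, $$\int_{t_0}^{t_1}\mathcal L_c(t,\sigma_t,\dot\sigma_t)\,dt\le\int_{t_0}^{t_1}\mathcal L_c(t,\tilde\sigma_t,\dot{\tilde\sigma}_t)\,dt .$$ An AC curve $q:\mathbf R\to S^1$ is $c$-minimal for $L$ if, for all $t_0<t_1$ and every AC curve $\tilde q:[t_0,t_1]\to S^1$ with $\tilde q(t_i)=q(t_i)$ for $i=0,1$, $$\int_{t_0}^{t_1}L_c(t,q,\dot q)\,dt\le\int_{t_0}^{t_1}L_c(t,\tilde q,\dot{\tilde q})\,dt .$$ *The constant $\alpha(c)$.* It is the unique $\alpha\in\mathbf R$ for which there is a continuous $U:L^2(I)\to\mathbf R$ such that $U(M+Z)=U(M)$ for all $Z\in L^2_{\mathbf Z}(I)$,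 $U(M\circ G)=U(M)$ for every bimeasurable bijection $G$ of $I$ preserving $\nu_0$, and $$U(M)=\alpha+\inf\Big\{\int_0^1\mathcal L_c(t,\gamma_t,\dot\gamma_t)\,dt+U(\gamma_1)\ :\ \gamma:[0,1]\to L^2(I)\ \text{AC},\ \gamma_0=M\Big\}\qquad\text{for all }M\in L^2(I).$$ **Lemma 2.13.** Let $c\in\mathbf R$ and let $\sigma:\mathbf R\to L^2(I)$ be $c$-minimal for $\mathcal L$. Assume that for every $t\in\mathbf R$ the class of $\sigma_t$ in $\mathbf T$ contains a nondecreasing function $M$ on $[0,1)$ with $M(1-)\le M(0)+1$, and that $$\liminf_{k\to+\infty,\ k\in\mathbf N}\int_{-k}^{k}\big[\mathcal L_c(t,\sigma_t,\dot\sigma_t)+\alpha(c)\big]\,dt<+\infty .$$ Then there is a curve $q:\mathbf R\to S^1$, $c$-minimal for $L$, such that $(\pi\circ\sigma_t)_\sharp\nu_0=\delta_{q(t)}$ for every $t\in\mathbf R$. -/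

import Mathlib

open MeasureTheory Set Filter

namespace VlasovCircle

noncomputable section

/-- The set `I = [0, 1)` of labels of the particles, with Lebesgue measure `ν₀ = volume`. -/
abbrev Label : Type := Set.Ico (0 : ℝ) 1

instance : MeasureSpace Label := Measure.Subtype.measureSpace

/-- The Hilbert space `L²(I) = L²(I, ℝ)`. -/
abbrev L2I : Type := Lp ℝ 2 (volume : Measure Label)

/-- The subgroup `L²_ℤ(I) = L²(I, ℤ)`; the space `𝐓` is the quotient `L²(I) / L²_ℤ(I)`. -/
def L2Z : Set L2I := {M | ∀ᵐ x : Label, ∃ n : ℤ, M x = n}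

/-- `Mon`: the (classes of) nondecreasing functions on `[0, 1)` with `M(1-) ≤ M(0) + 1`.
For a nondecreasing `f`, the limit `f(1-)` is the supremum of `f`. -/
def Mon : Set L2I :=
  {M | ∃ f : Label → ℝ, Monotone f ∧ (∀ x, f x ≤ f 0 + 1) ∧ M =ᵐ[volume] f}

/-- On the interval `K`, the curve `u` is absolutely continuous with derivative
`v ∈ L¹_loc(K, E)`: `u` is (the continuous representative of) a primitive of `v`. -/
def HasACDeriv {E : Type*} [NormedAddCommGroup E] [NormedSpace ℝ E] [CompleteSpace E]
    (K : Set ℝ) (u v : ℝ → E) : Prop :=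
  LocallyIntegrableOn v K volume ∧ ∀ s ∈ K, ∀ t ∈ K, u t - u s = ∫ r in s..t, v r

/-- On the interval `K`, the curve `q` in the circle `S¹ = ℝ / ℤ` is absolutely continuous with
derivative `p`: it has an absolutely continuous lift to `ℝ` with derivative `p`. -/
def HasACDerivCircle (K : Set ℝ) (q : ℝ → UnitAddCircle) (p : ℝ → ℝ) : Prop :=
  ∃ Q : ℝ → ℝ, HasACDeriv K Q p ∧ ∀ t ∈ K, (Q t : UnitAddCircle) = q t

open Classical in
/-- The integral over `[a, b]`, with values in `(-∞, +∞]`, of a function that is bounded below by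
an integrable function (as a Lagrangian along an absolutely continuous curve always is): it is
`+∞` if the function is not integrable. -/
def extIntegral (f : ℝ → ℝ) (a b : ℝ) : EReal :=
  if IntervalIntegrable f volume a b then ((∫ t in a..b, f t : ℝ) : EReal) else ⊤

/-- `𝓥(t, M) = ∫_I V(t, M z) dz`. -/
def externalEnergy (V : UnitAddCircle × UnitAddCircle → ℝ) (t : ℝ) (M : L2I) : ℝ :=
  ∫ z : Label, V ((t : UnitAddCircle), ((M z : ℝ) : UnitAddCircle))

/-- `𝓦(M) = (1/2) ∫_{I × I} W(M z - M z') dz dz'`. -/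
def interactionEnergy (W : UnitAddCircle → ℝ) (M : L2I) : ℝ :=
  (1 / 2) * ∫ z : Label, ∫ z' : Label, W ((M z - M z' : ℝ) : UnitAddCircle)

/-- `𝓛_c(t, M, N) = (1/2) ‖N‖² - 𝓥(t, M) - 𝓦(M) - ⟨c, N⟩`. -/
def vlasovLagrangian (V : UnitAddCircle × UnitAddCircle → ℝ) (W : UnitAddCircle → ℝ) (c : ℝ)
    (t : ℝ) (M N : L2I) : ℝ :=
  (1 / 2) * ‖N‖ ^ 2 - externalEnergy V t M - interactionEnergy W M - ∫ z : Label, c * N z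

/-- `L_c(t, q, p) = (1/2) |p|² - V(t, q) - c p`. -/
def particleLagrangian (V : UnitAddCircle × UnitAddCircle → ℝ) (c : ℝ)
    (t : ℝ) (q : UnitAddCircle) (p : ℝ) : ℝ :=
  (1 / 2) * p ^ 2 - V ((t : UnitAddCircle), q) - c * p

/-- The absolutely continuous curve `σ` in `L²(I)`, with derivative `v`, is `c`-minimal for `𝓛`
on the interval `K`. -/
def IsVlasovMinimal (V : UnitAddCircle × UnitAddCircle → ℝ) (W : UnitAddCircle → ℝ) (c : ℝ)
    (K : Set ℝ) (σ v : ℝ → L2I) : Prop :=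
  HasACDeriv K σ v ∧
    ∀ t₀ t₁ : ℝ, t₀ < t₁ → Icc t₀ t₁ ⊆ K →
      ∀ τ w : ℝ → L2I, HasACDeriv (Icc t₀ t₁) τ w →
        τ t₀ - σ t₀ ∈ L2Z → τ t₁ - σ t₁ ∈ L2Z →
          extIntegral (fun t => vlasovLagrangian V W c t (σ t) (v t)) t₀ t₁ ≤
            extIntegral (fun t => vlasovLagrangian V W c t (τ t) (w t)) t₀ t₁

/-- The absolutely continuous curve `q` in `S¹` is `c`-minimal for `L` on the interval `K`. -/
def IsParticleMinimal (V : UnitAddCircle × UnitAddCircle → ℝ) (c : ℝ)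
    (K : Set ℝ) (q : ℝ → UnitAddCircle) : Prop :=
  ∃ p : ℝ → ℝ, HasACDerivCircle K q p ∧
    ∀ t₀ t₁ : ℝ, t₀ < t₁ → Icc t₀ t₁ ⊆ K →
      ∀ (r : ℝ → UnitAddCircle) (s : ℝ → ℝ), HasACDerivCircle (Icc t₀ t₁) r s →
        r t₀ = q t₀ → r t₁ = q t₁ →
          extIntegral (fun t => particleLagrangian V c t (q t) (p t)) t₀ t₁ ≤
            extIntegral (fun t => particleLagrangian V c t (r t) (s t)) t₀ t₁

/-- The class `C_Group(𝐓)` of continuous functions on `L²(I)` that are invariant under the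
translations by `L²_ℤ(I)` and under the rearrangements `M ↦ M ∘ G`, where `G` is a bijection of `I`
that is measurable with its inverse and preserves Lebesgue measure. -/
structure IsGroupInvariant (U : L2I → ℝ) : Prop where
  continuous : Continuous U
  add_mem_L2Z : ∀ M : L2I, ∀ Z ∈ L2Z, U (M + Z) = U M
  comp_measurePreserving : ∀ (G : Label ≃ᵐ Label) (hG : MeasurePreserving G volume volume)
    (M : L2I), U (Lp.compMeasurePreserving G hG M) = U M

/-- The Lax-Oleinik transform
`Û(M) = inf { ∫₀¹ 𝓛_c(t, γ, γ') dt + U(γ 1) : γ ∈ AC([0, 1], L²(I)), γ 0 = M }`. -/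
def laxOleinik (V : UnitAddCircle × UnitAddCircle → ℝ) (W : UnitAddCircle → ℝ) (c : ℝ)
    (U : L2I → ℝ) (M : L2I) : EReal :=
  ⨅ (γ : ℝ → L2I) (w : ℝ → L2I) (_ : HasACDeriv (Icc 0 1) γ w ∧ γ 0 = M),
    extIntegral (fun t => vlasovLagrangian V W c t (γ t) (w t)) 0 1 + (U (γ 1) : EReal)

/-- `α(c)`: the unique real number `α` such that the operator `U ↦ Û + α` has a fixed point
in `C_Group(𝐓)`. -/
def criticalValue (V : UnitAddCircle × UnitAddCircle → ℝ) (W : UnitAddCircle → ℝ) (c : ℝ) : ℝ :=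
  Classical.epsilon fun α : ℝ =>
    ∃ U : L2I → ℝ, IsGroupInvariant U ∧
      ∀ M : L2I, laxOleinik V W c U M + (α : EReal) = (U M : EReal)

end

end VlasovCircle

/-! Since W ≤ 0 vanishes only at 0, the term -𝓦 of the Lagrangian is a nonnegative cost, zero
exactly when almost all particles sit at one point of the circle. Apart from it, the action of a
curve in L²(I) is the mean of the actions of its particles (`IsVersion.integral_fiber_action`), and
on constants the Vlasov Lagrangian is the particle Lagrangian (`tonelli_cst`). The heart of the
matter is that 𝓦(σ t) = 0 for all t.

The total interaction cost is finite. A Lax-Oleinik fixed point at level α(c), restricted to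
constants, gives a function u on the circle dominated by the particle Lagrangian at the same level
(`exists_dominated_criticalValue`). The mean of u over the particles is bounded, and its domination
inequality along σ has slack at least ∫ -𝓦 (`lift_domination`). The bound on the liminf then
controls ∫ -𝓦(σ t) dt on the whole line (`IsVlasovMinimal.exists_interaction_bound`).

The cost is in fact zero. At suitable times a → -∞ and b → +∞ the configuration is η-close to a
constant modulo integer-valued functions. Let all particles follow the particle z on [a, b], with
corrections by ramps of unit length at both ends; on average over z the corrections cost O(η),
uniformly in b - a. By minimality and this averaging, the action of σ is at most the same action
without interaction cost, plus O(η). Hence ∫ -𝓦 = O(η) over [a, b]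
(`IsVlasovMinimal.interaction_le_of_near`).

Once 𝓦 vanishes, almost all particles have the same motion q on the circle and the action of σ is
that of q; a competitor of q, viewed as a curve of constants, is a competitor of σ
(`IsVlasovMinimal.isParticleMinimal`).

Since `criticalValue` is a choice, a fixed point has to be produced (`exists_weakKAM`). Compactness
serves only on the circle; in L²(I) the Knaster–Tarski theorem gives a least fixed point between the
mean of a particle solution u and the function equal to u on constants and +∞ off them. -/

namespace VlasovCircle

/-! ### Absolutely continuous curves in a Banach space -/

section Framework

open Topology

variable {E : Type*} [NormedAddCommGroup E]

section AC

variable [NormedSpace ℝ E] [CompleteSpace E] {F : Type*} [NormedAddCommGroup F] [NormedSpace ℝ F]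
  [CompleteSpace F] {K : Set ℝ} {u v : ℝ → E} {a b : ℝ}

theorem HasACDeriv.mono {K' : Set ℝ} (h : HasACDeriv K u v) (hK : K' ⊆ K) : HasACDeriv K' u v :=
  ⟨h.1.mono_set hK, fun s hs t ht => h.2 s (hK hs) t (hK ht)⟩

theorem HasACDeriv.intervalIntegrable (h : HasACDeriv (Icc a b) u v) (hab : a ≤ b) :
    IntervalIntegrable v volume a b := by
  rw [intervalIntegrable_iff_integrableOn_Icc_of_le hab]
  exact h.1.integrableOn_isCompact isCompact_Icc

theorem hasACDeriv_Icc_of (hab : a ≤ b) (hv : IntervalIntegrable v volume a b)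
    (h : ∀ t ∈ Icc a b, u t = u a + ∫ r in a..t, v r) : HasACDeriv (Icc a b) u v := by
  refine ⟨((intervalIntegrable_iff_integrableOn_Icc_of_le hab).1 hv).locallyIntegrableOn, ?_⟩
  intro s hs t ht
  have hi : ∀ t ∈ Icc a b, IntervalIntegrable v volume a t := fun t ht =>
    hv.mono_set (by rw [uIcc_of_le ht.1, uIcc_of_le hab]; exact Icc_subset_Icc_right ht.2)
  rw [h s hs, h t ht, ← intervalIntegral.integral_interval_sub_left (hi t ht) (hi s hs)]
  abel

theorem HasACDeriv.eq_add_integral (h : HasACDeriv (Icc a b) u v) (hab : a ≤ b) :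
    ∀ t ∈ Icc a b, u t = u a + ∫ r in a..t, v r := by
  intro t ht
  rw [← h.2 a (left_mem_Icc.2 hab) t ht]; abel

theorem HasACDeriv.continuousOn (h : HasACDeriv (Icc a b) u v) (hab : a ≤ b) :
    ContinuousOn u (Icc a b) := by
  have h1 := intervalIntegral.continuousOn_primitive_interval (μ := volume) (f := v) (a := a)
    (b := b) (by
      rw [uIcc_of_le hab]; exact h.1.integrableOn_isCompact isCompact_Icc)
  rw [uIcc_of_le hab] at h1
  exact (continuousOn_const.add h1).congr (h.eq_add_integral hab)

theorem HasACDeriv.continuous (h : HasACDeriv univ u v) : Continuous u := by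
  rw [continuous_iff_continuousAt]
  intro t
  have h1 := (h.mono (subset_univ (Icc (t - 1) (t + 1)))).continuousOn (by linarith)
  exact h1.continuousAt (Icc_mem_nhds (by linarith) (by linarith))

theorem HasACDeriv.map (h : HasACDeriv (Icc a b) u v) (hab : a ≤ b) (L : E →L[ℝ] F) :
    HasACDeriv (Icc a b) (fun t => L (u t)) (fun t => L (v t)) := by
  have hv := h.intervalIntegrable hab
  refine hasACDeriv_Icc_of hab ⟨L.integrable_comp hv.1, L.integrable_comp hv.2⟩ ?_
  intro t ht
  rw [h.eq_add_integral hab t ht, map_add, ← L.intervalIntegral_comp_comm]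
  exact hv.mono_set (by rw [uIcc_of_le ht.1, uIcc_of_le hab]; exact Icc_subset_Icc_right ht.2)

theorem HasACDeriv.add {u' v' : ℝ → E} (h : HasACDeriv (Icc a b) u v)
    (h' : HasACDeriv (Icc a b) u' v') (hab : a ≤ b) :
    HasACDeriv (Icc a b) (fun t => u t + u' t) (fun t => v t + v' t) := by
  have hv := h.intervalIntegrable hab
  have hv' := h'.intervalIntegrable hab
  refine hasACDeriv_Icc_of hab (hv.add hv') ?_
  intro t ht
  have hs : uIcc a t ⊆ uIcc a b := by
    rw [uIcc_of_le ht.1, uIcc_of_le hab]; exact Icc_subset_Icc_right ht.2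
  rw [h.eq_add_integral hab t ht, h'.eq_add_integral hab t ht,
    intervalIntegral.integral_add (hv.mono_set hs) (hv'.mono_set hs)]
  abel

theorem HasACDeriv.add_const (h : HasACDeriv K u v) (x : E) :
    HasACDeriv K (fun t => u t + x) v :=
  ⟨h.1, fun s hs t ht => by rw [← h.2 s hs t ht, add_sub_add_right_eq_sub]⟩

theorem HasACDeriv.comp_add_right (h : HasACDeriv (Icc a b) u v) (hab : a ≤ b) (s : ℝ) :
    HasACDeriv (Icc (a - s) (b - s)) (fun t => u (t + s)) (fun t => v (t + s)) := by
  refine hasACDeriv_Icc_of (by linarith) ?_ ?_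
  · exact (h.intervalIntegrable hab).comp_add_right s
  · intro t ht
    rw [intervalIntegral.integral_comp_add_right (f := v)]
    simp only [sub_add_cancel]
    exact h.eq_add_integral hab _ ⟨by linarith [ht.1], by linarith [ht.2]⟩

theorem hasACDeriv_affine (hab : a ≤ b) (x w : E) :
    HasACDeriv (Icc a b) (fun t => x + (t - a) • w) (fun _ => w) := by
  refine hasACDeriv_Icc_of hab intervalIntegrable_const ?_
  intro t _
  simp

/-- Closed form of the ramp of unit length used to correct the ends of curves. -/
theorem integral_indicator_Ioc_unit {s t : ℝ} (has : a ≤ s) (hat : a ≤ t) :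
    ∫ r in a..t, (Ioc s (s + 1)).indicator (fun _ => (1 : ℝ)) r = max 0 (min t (s + 1) - s) := by
  rw [intervalIntegral.integral_of_le hat, setIntegral_indicator measurableSet_Ioc,
    Ioc_inter_Ioc, sup_of_le_right has]
  rcases le_total (min t (s + 1)) s with h | h
  · rw [Ioc_eq_empty (not_lt.2 h), max_eq_left (by linarith)]
    simp
  · rw [max_eq_right (by linarith)]
    simp [h, measureReal_def, ENNReal.toReal_ofReal]

end AC

/-! ### Mechanical Lagrangians on a Hilbert space -/

section Tonelli

variable [InnerProductSpace ℝ E]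

/-- The mechanical Lagrangian `‖w‖² / 2 - P(t, x) - ℓ w`. -/
noncomputable def tonelli (P : ℝ → E → ℝ) (ℓ : E →L[ℝ] ℝ) (t : ℝ) (x w : E) : ℝ :=
  1 / 2 * ‖w‖ ^ 2 - P t x - ℓ w

/-- A bounded continuous potential, Lipschitz in the space variable. -/
structure IsTame (P : ℝ → E → ℝ) (B K : ℝ) : Prop where
  cont : Continuous (fun p : ℝ × E => P p.1 p.2)
  bound : ∀ t x, |P t x| ≤ B
  lip : ∀ t x y, |P t x - P t y| ≤ K * ‖x - y‖

variable [CompleteSpace E] {P : ℝ → E → ℝ} {B K : ℝ} (hP : IsTame P B K) (ℓ : E →L[ℝ] ℝ)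
  {γ w : ℝ → E} {a b : ℝ}

include hP

theorem IsTame.continuousOn_comp (hγ : HasACDeriv (Icc a b) γ w) (hab : a ≤ b) :
    ContinuousOn (fun t => P t (γ t)) (Icc a b) :=
  hP.cont.comp_continuousOn (continuousOn_id.prodMk (hγ.continuousOn hab))

theorem IsTame.intervalIntegrable_comp (hγ : HasACDeriv (Icc a b) γ w) (hab : a ≤ b) :
    IntervalIntegrable (fun t => P t (γ t)) volume a b := by
  apply ContinuousOn.intervalIntegrable
  rw [uIcc_of_le hab]; exact hP.continuousOn_comp hγ hab

omit hP in
theorem HasACDeriv.intervalIntegrable_clm (hγ : HasACDeriv (Icc a b) γ w) (hab : a ≤ b) :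
    IntervalIntegrable (fun t => ℓ (w t)) volume a b :=
  (hγ.map hab ℓ).intervalIntegrable hab

/-- The potential is continuous along the curve and ℓ is linear in an integrable velocity, so only
the kinetic term can fail to be integrable. -/
theorem IsTame.intervalIntegrable_tonelli_iff (hγ : HasACDeriv (Icc a b) γ w) (hab : a ≤ b) :
    IntervalIntegrable (fun t => tonelli P ℓ t (γ t) (w t)) volume a b ↔
      IntervalIntegrable (fun t => ‖w t‖ ^ 2) volume a b := by
  have h1 := hP.intervalIntegrable_comp hγ hab
  have h2 := hγ.intervalIntegrable_clm ℓ hab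
  constructor
  · intro h
    have := ((h.add h1).add h2).const_mul 2
    refine this.congr (fun t _ => ?_)
    simp only [tonelli]; ring
  · intro h
    exact ((h.const_mul (1 / 2)).sub h1).sub h2

omit [CompleteSpace E] in
theorem IsTame.le_tonelli (t : ℝ) (x w : E) :
    1 / 4 * ‖w‖ ^ 2 - B - ‖ℓ‖ ^ 2 ≤ tonelli P ℓ t x w := by
  have h1 := (abs_le.1 (hP.bound t x)).2
  have h2 := (le_abs_self _).trans (ℓ.le_opNorm w)
  unfold tonelli
  -- Young: ‖ℓ‖‖w‖ ≤ ‖w‖² / 4 + ‖ℓ‖², which leaves a quarter of the kinetic term.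
  nlinarith [sq_nonneg (‖w‖ / 2 - ‖ℓ‖)]

theorem IsTame.integral_sq_le (hγ : HasACDeriv (Icc a b) γ w) (hab : a ≤ b)
    (h2 : IntervalIntegrable (fun t => ‖w t‖ ^ 2) volume a b) :
    1 / 4 * (∫ t in a..b, ‖w t‖ ^ 2) - (B + ‖ℓ‖ ^ 2) * (b - a) ≤
      ∫ t in a..b, tonelli P ℓ t (γ t) (w t) := by
  have h3 := (hP.intervalIntegrable_tonelli_iff ℓ hγ hab).2 h2
  calc _ = ∫ t in a..b, (1 / 4 * ‖w t‖ ^ 2 - (B + ‖ℓ‖ ^ 2)) := by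
        rw [intervalIntegral.integral_sub (h2.const_mul _) intervalIntegrable_const,
          intervalIntegral.integral_const_mul, intervalIntegral.integral_const, smul_eq_mul]
        ring
    _ ≤ _ := by
        apply intervalIntegral.integral_mono_on hab
          ((h2.const_mul _).sub intervalIntegrable_const) h3
        intro t _
        linarith [hP.le_tonelli ℓ t (γ t) (w t)]

omit hP in
theorem HasACDeriv.norm_sub_le (hγ : HasACDeriv (Icc a b) γ w) (hab : a ≤ b)
    (h2 : IntervalIntegrable (fun t => ‖w t‖ ^ 2) volume a b) {s t : ℝ} (has : a ≤ s)
    (hst : s ≤ t) (htb : t ≤ b) :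
    ‖γ t - γ s‖ ≤ 1 / 2 * (∫ r in a..b, ‖w r‖ ^ 2) + 1 / 2 * (t - s) := by
  have hw := hγ.intervalIntegrable hab
  have hsub : uIcc s t ⊆ uIcc a b := by
    rw [uIcc_of_le hst, uIcc_of_le hab]; exact Icc_subset_Icc has htb
  rw [hγ.2 s ⟨has, hst.trans htb⟩ t ⟨has.trans hst, htb⟩]
  calc _ ≤ ∫ r in s..t, ‖w r‖ := intervalIntegral.norm_integral_le_integral_norm hst
    _ ≤ ∫ r in s..t, (1 / 2 * ‖w r‖ ^ 2 + 1 / 2) := by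
        apply intervalIntegral.integral_mono_on hst (hw.mono_set hsub).norm
          (((h2.mono_set hsub).const_mul _).add intervalIntegrable_const)
        intro r _
        -- Pointwise ‖w‖ ≤ (‖w‖² + 1) / 2 takes the place of Cauchy–Schwarz.
        nlinarith [sq_nonneg (‖w r‖ - 1)]
    _ = 1 / 2 * (∫ r in s..t, ‖w r‖ ^ 2) + 1 / 2 * (t - s) := by
        rw [intervalIntegral.integral_add ((h2.mono_set hsub).const_mul _) intervalIntegrable_const,
          intervalIntegral.integral_const_mul, intervalIntegral.integral_const, smul_eq_mul]
        ring
    _ ≤ _ := by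
        have : ∫ r in s..t, ‖w r‖ ^ 2 ≤ ∫ r in a..b, ‖w r‖ ^ 2 :=
          intervalIntegral.integral_mono_interval has hst htb
            (ae_of_all _ fun r => by positivity) h2
        linarith

theorem IsTame.integral_affine_le (a : ℝ) (x y : E) :
    ∫ t in a..(a + 1), tonelli P ℓ t (x + (t - a) • y) y ≤
      1 / 2 * ‖y‖ ^ 2 + B + ‖ℓ‖ * ‖y‖ := by
  have hab : a ≤ a + 1 := by linarith
  have h3 := (hP.intervalIntegrable_tonelli_iff ℓ (hasACDeriv_affine hab x y) hab).2
    intervalIntegrable_const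
  calc _ ≤ ∫ t in a..(a + 1), (1 / 2 * ‖y‖ ^ 2 + B + ‖ℓ‖ * ‖y‖) := by
        apply intervalIntegral.integral_mono_on hab h3 intervalIntegrable_const
        intro t _
        have h1 := (abs_le.1 (hP.bound t (x + (t - a) • y))).1
        have h2 := (neg_abs_le _).trans' (neg_le_neg (ℓ.le_opNorm y))
        unfold tonelli
        linarith
    _ = _ := by simp

/-- Effect on the action of adding to a curve the vector `h` times a ramp of unit length. -/
theorem IsTame.action_perturb_le (hγ : HasACDeriv (Icc a b) γ w) (hab : a ≤ b) (hK : 0 ≤ K)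
    (h2 : IntervalIntegrable (fun t => ‖w t‖ ^ 2) volume a b) {s ε φ₀ : ℝ} (has : a ≤ s)
    (hsb : s + 1 ≤ b) (hε : ε ^ 2 = 1) {φ : ℝ → ℝ}
    (hφ : ∀ t, φ t = φ₀ + ε * max 0 (min t (s + 1) - s))
    (hφ1 : ∀ t ∈ Icc a b, |φ t| ≤ (Icc s (s + 1)).indicator (fun _ => 1) t) (h : E) :
    ∃ w' : ℝ → E, HasACDeriv (Icc a b) (fun t => γ t + φ t • h) w' ∧
      IntervalIntegrable (fun t => ‖w' t‖ ^ 2) volume a b ∧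
      ∫ t in a..b, tonelli P ℓ t (γ t + φ t • h) (w' t) ≤
        (∫ t in a..b, tonelli P ℓ t (γ t) (w t)) + ε * inner ℝ (γ (s + 1) - γ s) h
          + 1 / 2 * ‖h‖ ^ 2 + (K + ‖ℓ‖) * ‖h‖ := by
  set ind : ℝ → ℝ := (Ioc s (s + 1)).indicator (fun _ => (1 : ℝ)) with hind
  -- The closed interval is needed: a descending ramp equals 1 at s. `jnd` dominates both |φ| and
  -- |φ'|, hence all error terms.
  set jnd : ℝ → ℝ := (Icc s (s + 1)).indicator (fun _ => (1 : ℝ)) with hjnd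
  have hw := hγ.intervalIntegrable hab
  have hsb' : s ≤ b := by linarith
  have hindint : ∀ x y : ℝ, IntervalIntegrable ind volume x y := fun x y =>
    (integrable_indicator_iff measurableSet_Ioc |>.2 (by simp)).intervalIntegrable
  have hjndint : ∀ x y : ℝ, IntervalIntegrable jnd volume x y := fun x y =>
    (integrable_indicator_iff measurableSet_Icc |>.2 (by simp)).intervalIntegrable
  have hφac : HasACDeriv (Icc a b) φ (fun t => ε * ind t) := by
    refine hasACDeriv_Icc_of hab ((hindint a b).const_mul ε) ?_
    intro t ht
    rw [intervalIntegral.integral_const_mul, integral_indicator_Ioc_unit has ht.1, hφ, hφ a,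
      max_eq_left (a := 0) (b := min a (s + 1) - s)]
    · ring
    · linarith [min_le_left a (s + 1)]
  have hL := hφac.map hab (ContinuousLinearMap.toSpanSingleton ℝ h)
  simp only [ContinuousLinearMap.toSpanSingleton_apply] at hL
  have hac := hγ.add hL hab
  have hind01 : ∀ t, ind t ^ 2 = ind t := by
    intro t; simp only [hind, indicator]; split_ifs <;> norm_num
  have hindj : ∀ t, 0 ≤ ind t ∧ ind t ≤ jnd t := by
    intro t
    simp only [hind, hjnd, indicator]
    split_ifs with h1 h2 h2
    · norm_num
    · exact absurd (Ioc_subset_Icc_self h1) h2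
    · norm_num
    · norm_num
  have hinner : ∀ x : E, inner ℝ x h = innerSL ℝ h x := fun x => by
    rw [innerSL_apply_apply, real_inner_comm]
  have hsub : uIcc s (s + 1) ⊆ uIcc a b := by
    rw [uIcc_of_le (by linarith), uIcc_of_le hab]; exact Icc_subset_Icc has hsb
  have hwh : IntervalIntegrable (fun t => inner ℝ (w t) h) volume a b := by
    simp only [hinner]; exact hγ.intervalIntegrable_clm (innerSL ℝ h) hab
  have hwhi : IntervalIntegrable (fun t => ind t * inner ℝ (w t) h) volume a b := by
    have : (fun t => ind t * inner ℝ (w t) h)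
        = (Ioc s (s + 1)).indicator (fun t => inner ℝ (w t) h) := by
      ext t; simp only [hind, indicator]; split_ifs <;> simp
    rw [this]
    exact ⟨hwh.1.indicator measurableSet_Ioc, hwh.2.indicator measurableSet_Ioc⟩
  -- The cross term of the kinetic energy sees the curve only through its displacement during the
  -- ramp.
  have hwhv : ∫ t in a..b, ind t * inner ℝ (w t) h = inner ℝ (γ (s + 1) - γ s) h := by
    have : (fun t => ind t * inner ℝ (w t) h)
        = (Ioc s (s + 1)).indicator (fun t => inner ℝ (w t) h) := by
      ext t; simp only [hind, indicator]; split_ifs <;> simp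
    rw [this, intervalIntegral.integral_of_le hab, setIntegral_indicator measurableSet_Ioc,
      Ioc_inter_Ioc, sup_of_le_right has, inf_of_le_right hsb,
      ← intervalIntegral.integral_of_le (by linarith),
      hγ.2 s ⟨has, hsb'⟩ (s + 1) ⟨by linarith, hsb⟩]
    simp only [hinner]
    exact (innerSL ℝ h).intervalIntegral_comp_comm (hw.mono_set hsub)
  have hexp : ∀ t, ‖w t + (ε * ind t) • h‖ ^ 2
      = ‖w t‖ ^ 2 + 2 * ε * (ind t * inner ℝ (w t) h) + ind t * ‖h‖ ^ 2 := by
    intro t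
    rw [norm_add_sq_real, inner_smul_right, norm_smul, mul_pow, Real.norm_eq_abs, sq_abs, mul_pow,
      hε, hind01]
    ring
  have hsq' : IntervalIntegrable (fun t => ‖w t + (ε * ind t) • h‖ ^ 2) volume a b := by
    simp only [hexp]
    exact (h2.add (hwhi.const_mul _)).add ((hindint a b).mul_const _)
  refine ⟨_, hac, hsq', ?_⟩
  have hT := (hP.intervalIntegrable_tonelli_iff ℓ hγ hab).2 h2
  have hT' := (hP.intervalIntegrable_tonelli_iff ℓ hac hab).2 hsq'
  have hjv : ∫ t in a..b, jnd t = 1 := by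
    rw [intervalIntegral.integral_of_le hab, ← integral_Icc_eq_integral_Ioc,
      setIntegral_indicator measurableSet_Icc, Icc_inter_Icc, sup_of_le_right has,
      inf_of_le_right hsb]
    simp
  set C : ℝ := 1 / 2 * ‖h‖ ^ 2 + (K + ‖ℓ‖) * ‖h‖ with hC
  calc _ ≤ ∫ t in a..b, (tonelli P ℓ t (γ t) (w t) + ε * (ind t * inner ℝ (w t) h)
          + C * jnd t) := by
        apply intervalIntegral.integral_mono_on hab hT'
          ((hT.add (hwhi.const_mul _)).add ((hjndint a b).const_mul _))
        intro t ht
        have e1 := (abs_le.1 (hP.lip t (γ t + φ t • h) (γ t))).1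
        rw [add_sub_cancel_left, norm_smul, Real.norm_eq_abs] at e1
        have e2 : |φ t| * ‖h‖ ≤ jnd t * ‖h‖ :=
          mul_le_mul_of_nonneg_right (hφ1 t ht) (norm_nonneg _)
        have e3 : ‖ε * ind t‖ ≤ jnd t := by
          have : |ε| = 1 := by
            rcases sq_eq_one_iff.1 hε with h | h <;> simp [h]
          rw [Real.norm_eq_abs, abs_mul, this, one_mul, abs_of_nonneg (hindj t).1]
          exact (hindj t).2
        have e4 : -(jnd t * (‖ℓ‖ * ‖h‖)) ≤ (ε * ind t) * ℓ h := by
          have : |(ε * ind t) * ℓ h| ≤ jnd t * (‖ℓ‖ * ‖h‖) := by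
            rw [abs_mul]
            exact mul_le_mul e3 (ℓ.le_opNorm h) (abs_nonneg _) ((norm_nonneg _).trans e3)
          exact (abs_le.1 this).1
        have e5 := mul_le_mul_of_nonneg_left e2 hK
        have e6 := mul_le_mul_of_nonneg_right (hindj t).2 (sq_nonneg ‖h‖)
        simp only [tonelli, hexp, map_add, map_smul, smul_eq_mul, hC]
        linarith
    _ = _ := by
        rw [intervalIntegral.integral_add (hT.add (hwhi.const_mul _))
            ((hjndint a b).const_mul _), intervalIntegral.integral_add hT (hwhi.const_mul _),
          intervalIntegral.integral_const_mul, intervalIntegral.integral_const_mul, hwhv, hjv, hC]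
        ring

end Tonelli

end Framework

/-! ### From curves in L²(I) to trajectories of particles -/

section Evaluation

open Topology ENNReal

instance instIsProbabilityMeasureLabel : IsProbabilityMeasure (volume : Measure Label) := by
  constructor
  have : (volume : Measure Label) = Measure.comap Subtype.val volume := rfl
  rw [this, comap_subtype_coe_apply measurableSet_Ico, image_univ, Subtype.range_coe]
  simp

instance instSecondCountableL2I : SecondCountableTopology L2I := by
  have : Fact ((2 : ℝ≥0∞) ≠ ⊤) := ⟨by simp⟩
  infer_instance

theorem lintegral_enorm_le_norm (M : L2I) : ∫⁻ z, ‖M z‖ₑ ≤ ‖M‖ₑ := by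
  rw [← eLpNorm_one_eq_lintegral_enorm, Lp.enorm_def]
  exact eLpNorm_le_eLpNorm_of_exponent_le (by norm_num) (Lp.aestronglyMeasurable M)

/-- A strongly measurable family in `L²(I)` has a jointly measurable version. -/
theorem exists_measurable_uncurry {α : Type*} [MeasurableSpace α] {v : α → L2I}
    (hv : StronglyMeasurable v) :
    ∃ f : α × Label → ℝ, Measurable f ∧ ∀ t, ∀ᵐ z, f (t, z) = v t z := by
  classical
  set D : ℕ → L2I := TopologicalSpace.denseSeq L2I
  have hD : DenseRange D := TopologicalSpace.denseRange_denseSeq L2I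
  have hex : ∀ (k : ℕ) (t : α), ∃ n, ‖D n - v t‖ < (1 / 2) ^ k := by
    intro k t
    obtain ⟨n, hn⟩ := hD.exists_dist_lt (v t) (ε := (1 / 2) ^ k) (by positivity)
    exact ⟨n, by rwa [dist_comm, dist_eq_norm] at hn⟩
  -- The first point of a dense sequence within 2⁻ᵏ of `v t` depends measurably on t. These
  -- countably valued approximations have evident joint versions.
  set N : ℕ → α → ℕ := fun k t => Nat.find (hex k t)
  have hN : ∀ k, Measurable (N k) := by
    intro k
    apply measurable_find
    intro n
    exact ((stronglyMeasurable_const.sub hv).norm.measurable) measurableSet_Iio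
  have hNk : ∀ k t, ‖D (N k t) - v t‖ < (1 / 2) ^ k := fun k t => Nat.find_spec (hex k t)
  set e : ℕ → α × Label → ℝ := fun k p => D (N k p.1) p.2
  have he : ∀ k, Measurable (e k) := by
    intro k
    have h1 : Measurable (fun q : ℕ × Label => D q.1 q.2) :=
      measurable_from_prod_countable_right fun n => (Lp.stronglyMeasurable (D n)).measurable
    exact h1.comp ((hN k |>.comp measurable_fst).prodMk measurable_snd)
  -- The limsup is measurable without any convergence. For each t the errors are summable in L¹, so
  -- almost everywhere in z it is a true limit.
  refine ⟨fun p => limsup (fun k => e k p) atTop, Measurable.limsup he, fun t => ?_⟩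
  have hsum : ∫⁻ z, ∑' k, ‖(D (N k t) - v t : L2I) z‖ₑ ≠ ⊤ := by
    rw [lintegral_tsum fun k => (Lp.stronglyMeasurable _).measurable.enorm.aemeasurable]
    refine ne_top_of_le_ne_top ?_ (ENNReal.tsum_le_tsum fun k =>
      (lintegral_enorm_le_norm _).trans ?_) (b := ∑' k : ℕ, (1 / 2 : ℝ≥0∞) ^ k)
    · rw [ENNReal.tsum_geometric, one_div, ENNReal.one_sub_inv_two, inv_inv]; simp
    · rw [← ofReal_norm]
      refine (ENNReal.ofReal_le_ofReal (hNk k t).le).trans ?_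
      rw [ENNReal.ofReal_pow (by norm_num)]
      gcongr
      rw [ENNReal.ofReal_div_of_pos (by norm_num)]; simp
  have hsub : ∀ᵐ z, ∀ k, (D (N k t) - v t : L2I) z = D (N k t) z - v t z := by
    rw [ae_all_iff]; exact fun k => Lp.coeFn_sub _ _
  filter_upwards [ae_lt_top (Measurable.tsum fun k =>
    (Lp.stronglyMeasurable (D (N k t) - v t)).measurable.enorm) hsum, hsub] with z hz hs
  have h0 := ENNReal.tendsto_atTop_zero_of_tsum_ne_top hz.ne
  have h1 : Tendsto (fun k => D (N k t) z) atTop (𝓝 (v t z)) := by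
    rw [tendsto_iff_edist_tendsto_0]
    refine h0.congr fun k => ?_
    rw [hs k, edist_eq_enorm_sub]
  exact h1.limsup_eq

/-- The jointly measurable function `f` represents the family `v` for almost every time in
`[a, b]`. -/
structure IsVersion (a b : ℝ) (v : ℝ → L2I) (f : ℝ × Label → ℝ) : Prop where
  measurable : Measurable f
  ae_eq : ∀ᵐ t ∂volume.restrict (Ioc a b), ∀ᵐ z, f (t, z) = v t z

/-- One version f serves all subintervals, so the trajectories built on different intervals are
compatible. -/
theorem exists_isVersion {v : ℝ → L2I} {S : Set ℝ}
    (hv : AEStronglyMeasurable v (volume.restrict S)) :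
    ∃ f, ∀ a b, Ioc a b ⊆ S → IsVersion a b v f := by
  obtain ⟨f, hf, hfv⟩ := exists_measurable_uncurry hv.stronglyMeasurable_mk
  refine ⟨f, fun a b hab => ⟨hf, ?_⟩⟩
  filter_upwards [ae_restrict_of_ae_restrict_of_subset hab hv.ae_eq_mk] with t ht
  rw [ht]; exact hfv t

variable {a b : ℝ} {v σ : ℝ → L2I} {f : ℝ × Label → ℝ}

theorem L2I.integrable (M : L2I) : Integrable (fun z => M z) volume :=
  (Lp.memLp M).integrable (by norm_num)

theorem L2I.integrable_sq (M : L2I) : Integrable (fun z => M z ^ 2) volume :=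
  (Lp.memLp M).integrable_sq

theorem L2I.integral_sq (M : L2I) : ∫ z, M z ^ 2 = ‖M‖ ^ 2 := by
  rw [← real_inner_self_eq_norm_sq, L2.inner_def]
  congr 1; ext z; simp [sq]

theorem L2I.integral_abs_mul_le (M N : L2I) : ∫ z, |M z| * |N z| ≤ ‖M‖ * ‖N‖ := by
  have h1 : ∫ z, |M z| * |N z| = inner ℝ (|M|) (|N|) := by
    rw [L2.inner_def]
    refine integral_congr_ae ?_
    filter_upwards [Lp.coeFn_abs M, Lp.coeFn_abs N] with z h1 h2
    simp [h1, h2, mul_comm]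
  rw [h1]
  refine (real_inner_le_norm _ _).trans ?_
  rw [norm_abs_eq_norm, norm_abs_eq_norm]

theorem L2I.integral_abs_le (M : L2I) : ∫ z, |M z| ≤ ‖M‖ := by
  have h1 : ∫ z, |M z| = ∫ z, ‖M z‖ := rfl
  rw [h1, integral_norm_eq_lintegral_enorm (Lp.aestronglyMeasurable M), ← toReal_enorm]
  exact ENNReal.toReal_mono (by simp) (lintegral_enorm_le_norm M)

theorem IsVersion.mono (hf : IsVersion a b v f) {a' b' : ℝ} (h : Ioc a' b' ⊆ Ioc a b) :
    IsVersion a' b' v f :=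
  ⟨hf.measurable, ae_restrict_of_ae_restrict_of_subset h hf.ae_eq⟩

theorem IsVersion.integrable_prod (hf : IsVersion a b v f)
    (hv : IntegrableOn v (Ioc a b) volume) :
    Integrable f ((volume.restrict (Ioc a b)).prod volume) := by
  rw [integrable_prod_iff hf.measurable.aestronglyMeasurable]
  constructor
  · filter_upwards [hf.ae_eq] with t ht
    exact (L2I.integrable (v t)).congr (ht.mono fun z hz => hz.symm)
  · refine Integrable.mono' hv.norm
      (hf.measurable.norm.stronglyMeasurable.integral_prod_right').aestronglyMeasurable ?_
    filter_upwards [hf.ae_eq] with t ht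
    rw [Real.norm_of_nonneg (integral_nonneg fun z => norm_nonneg _)]
    calc _ = ∫ z, |v t z| := integral_congr_ae (ht.mono fun z hz => by simp [hz])
      _ ≤ _ := L2I.integral_abs_le _

theorem IsVersion.integrable_prod_sq (hf : IsVersion a b v f)
    (hv : IntegrableOn (fun t => ‖v t‖ ^ 2) (Ioc a b) volume) :
    Integrable (fun p => f p ^ 2) ((volume.restrict (Ioc a b)).prod volume) := by
  rw [integrable_prod_iff (hf.measurable.pow_const 2).aestronglyMeasurable]
  constructor
  · filter_upwards [hf.ae_eq] with t ht
    exact (L2I.integrable_sq (v t)).congr (ht.mono fun z hz => by simp [hz])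
  · refine hv.congr ?_
    filter_upwards [hf.ae_eq] with t ht
    rw [← L2I.integral_sq]
    exact integral_congr_ae (ht.mono fun z hz => by simp [hz])

/-- Evaluation at z is not continuous on L²(I), so the identity is tested on sets S: the form M ↦
∫_S M is continuous and commutes with the Bochner integral, while Fubini handles the left side. -/
theorem IsVersion.integral_ae_eq (hf : IsVersion a b v f)
    (hv : IntegrableOn v (Ioc a b) volume) :
    ∀ᵐ z, ∫ s in Ioc a b, f (s, z) = (∫ s in Ioc a b, v s) z := by
  have hi := hf.integrable_prod hv
  have hi' : Integrable (fun z => ∫ s in Ioc a b, f (s, z)) volume := hi.integral_prod_right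
  refine hi'.ae_eq_of_forall_setIntegral_eq _ _ (L2I.integrable _) ?_
  intro S hS _
  have hSr : Integrable f ((volume.restrict (Ioc a b)).prod (volume.restrict S)) := by
    have : (volume.restrict (Ioc a b)).prod ((volume : Measure Label).restrict S)
        = ((volume.restrict (Ioc a b)).prod volume).restrict (univ ×ˢ S) := by
      rw [← Measure.prod_restrict, Measure.restrict_univ]
    rw [this]; exact hi.restrict
  have key : ∀ M : L2I, ∫ z in S, M z = inner ℝ (indicatorConstLp 2 hS (measure_ne_top _ S) (1 : ℝ)) M := by
    intro M
    rw [L2.inner_indicatorConstLp_one]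
  calc ∫ z in S, ∫ s in Ioc a b, f (s, z) = ∫ s in Ioc a b, ∫ z in S, f (s, z) :=
        (integral_integral_swap (f := fun s z => f (s, z)) hSr).symm
    _ = ∫ s in Ioc a b, innerSL ℝ (indicatorConstLp 2 hS (measure_ne_top _ S) (1 : ℝ)) (v s) := by
        refine integral_congr_ae ?_
        filter_upwards [hf.ae_eq] with s hs
        rw [innerSL_apply_apply, ← key]
        exact integral_congr_ae (ae_restrict_of_ae hs)
    _ = innerSL ℝ (indicatorConstLp 2 hS (measure_ne_top _ S) (1 : ℝ)) (∫ s in Ioc a b, v s) :=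
        ContinuousLinearMap.integral_comp_comm _ hv
    _ = _ := by rw [innerSL_apply_apply, ← key]

/-- The trajectory of the particle `z` with initial position `M z` and velocity `f (·, z)`. -/
noncomputable def fiberPath (M : L2I) (f : ℝ × Label → ℝ) (a : ℝ) (z : Label) (t : ℝ) : ℝ :=
  M z + ∫ s in a..t, f (s, z)

theorem IsVersion.fiberPath_ae_eq (hf : IsVersion a b v f) (hσ : HasACDeriv (Icc a b) σ v)
    (hab : a ≤ b) {t : ℝ} (ht : t ∈ Icc a b) :
    ∀ᵐ z, fiberPath (σ a) f a z t = σ t z := by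
  have hv : IntegrableOn v (Ioc a t) volume :=
    ((hσ.intervalIntegrable hab).1).mono_set (Ioc_subset_Ioc_right ht.2)
  have h1 := (hf.mono (Ioc_subset_Ioc_right ht.2)).integral_ae_eq hv
  have h2 : σ t = σ a + ∫ s in Ioc a t, v s := by
    rw [hσ.eq_add_integral hab t ht, intervalIntegral.integral_of_le ht.1]
  filter_upwards [h1, Lp.coeFn_add (σ a) (∫ s in Ioc a t, v s)] with z h1 h3
  rw [h2, h3, fiberPath, intervalIntegral.integral_of_le ht.1, h1]
  rfl

theorem IsVersion.fiberPath_hasACDeriv (hf : IsVersion a b v f) (hσ : HasACDeriv (Icc a b) σ v)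
    (hab : a ≤ b) :
    ∀ᵐ z, HasACDeriv (Icc a b) (fiberPath (σ a) f a z) (fun t => f (t, z)) := by
  filter_upwards [(hf.integrable_prod (hσ.intervalIntegrable hab).1).prod_left_ae] with z hz
  refine hasACDeriv_Icc_of hab ?_ fun t _ => ?_
  · rw [intervalIntegrable_iff_integrableOn_Ioc_of_le hab]; exact hz
  · simp [fiberPath]

theorem IsVersion.fiberPath_sq (hf : IsVersion a b v f) (hab : a ≤ b)
    (h2 : IntervalIntegrable (fun t => ‖v t‖ ^ 2) volume a b) :
    ∀ᵐ z, IntervalIntegrable (fun t => ‖f (t, z)‖ ^ 2) volume a b := by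
  filter_upwards [(hf.integrable_prod_sq h2.1).prod_left_ae] with z hz
  rw [intervalIntegrable_iff_integrableOn_Ioc_of_le hab]
  simpa [IntegrableOn] using hz

/-- An indicator moves the variable endpoint t into the integrand, so that measurability of
integrals with a parameter applies. -/
theorem IsVersion.measurable_fiberPath (hf : IsVersion a b v f) (M : L2I) :
    ∃ g : ℝ × Label → ℝ, Measurable g ∧ ∀ t ∈ Ioc a b, ∀ z, g (t, z) = fiberPath M f a z t := by
  refine ⟨fun p => M p.2 + ∫ s in Ioc a b, {q : (ℝ × Label) × ℝ | q.2 ≤ q.1.1}.indicator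
    (fun q => f (q.2, q.1.2)) (p, s), ?_, ?_⟩
  · refine ((Lp.stronglyMeasurable M).measurable.comp measurable_snd).add ?_
    have hm : MeasurableSet {q : (ℝ × Label) × ℝ | q.2 ≤ q.1.1} :=
      measurableSet_le measurable_snd (measurable_fst.comp measurable_fst)
    have := ((hf.measurable.comp (measurable_snd.prodMk
      (measurable_snd.comp measurable_fst))).indicator hm).stronglyMeasurable
    exact (this.integral_prod_right' (ν := volume.restrict (Ioc a b))).measurable
  · intro t ht z
    simp only [fiberPath]
    rw [intervalIntegral.integral_of_le ht.1.le]
    congr 1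
    have : ∀ s, {q : (ℝ × Label) × ℝ | q.2 ≤ q.1.1}.indicator
        (fun q => f (q.2, q.1.2)) ((t, z), s) = (Iic t).indicator (fun s => f (s, z)) s := by
      intro s; simp [indicator]
    simp only [this]
    rw [setIntegral_indicator measurableSet_Iic, Ioc_inter_Iic, inf_of_le_right ht.2]

variable {V : UnitAddCircle × UnitAddCircle → ℝ} {B K : ℝ}

/-- The potential of a particle, as a function on the line. -/
noncomputable def liftPotential (V : UnitAddCircle × UnitAddCircle → ℝ) (t x : ℝ) : ℝ :=
  V ((t : UnitAddCircle), (x : UnitAddCircle))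

theorem particleLagrangian_eq_tonelli (c t x p : ℝ) :
    particleLagrangian V c t x p
      = tonelli (liftPotential V) (c • ContinuousLinearMap.id ℝ ℝ) t x p := by
  simp [particleLagrangian, tonelli, liftPotential]

/-- The action of a curve in `L²(I)`, without interaction, is the mean of the actions of the
particles. -/
theorem IsVersion.integral_fiber_action (hf : IsVersion a b v f)
    (hσ : HasACDeriv (Icc a b) σ v) (hab : a ≤ b)
    (h2 : IntervalIntegrable (fun t => ‖v t‖ ^ 2) volume a b)
    (hV : IsTame (liftPotential V) B K) (c : ℝ) :
    Integrable (fun z => ∫ t in a..b, particleLagrangian V c t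
        (fiberPath (σ a) f a z t : ℝ) (f (t, z))) volume ∧
      ∫ z, (∫ t in a..b, particleLagrangian V c t (fiberPath (σ a) f a z t : ℝ) (f (t, z)))
        = ∫ t in a..b, (1 / 2 * ‖v t‖ ^ 2 - externalEnergy V t (σ t) - ∫ z, c * v t z) := by
  have hv := (hσ.intervalIntegrable hab).1
  obtain ⟨g, hg, hgp⟩ := hf.measurable_fiberPath (σ a)
  set G : ℝ × Label → ℝ := fun p =>
    1 / 2 * f p ^ 2 - liftPotential V p.1 (g p) - c * f p with hG
  have hVm : Measurable fun p : ℝ × Label => liftPotential V p.1 (g p) :=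
    hV.cont.measurable.comp (measurable_fst.prodMk hg)
  have hVi : Integrable (fun p : ℝ × Label => liftPotential V p.1 (g p))
      ((volume.restrict (Ioc a b)).prod volume) :=
    Integrable.of_bound hVm.aestronglyMeasurable B (ae_of_all _ fun p => hV.bound _ _)
  have hGi : Integrable G ((volume.restrict (Ioc a b)).prod volume) :=
    (((hf.integrable_prod_sq h2.1).const_mul _).sub hVi).sub
      ((hf.integrable_prod hv).const_mul c)
  have hcongr : ∀ z, ∫ t in a..b, particleLagrangian V c t
      (fiberPath (σ a) f a z t : ℝ) (f (t, z)) = ∫ t in Ioc a b, G (t, z) := by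
    intro z
    rw [intervalIntegral.integral_of_le hab]
    refine setIntegral_congr_fun measurableSet_Ioc fun t ht => ?_
    simp only [hG, hgp t ht z]
    rfl
  simp only [hcongr]
  refine ⟨hGi.integral_prod_right, ?_⟩
  rw [← integral_integral_swap (f := fun t z => G (t, z)) hGi, intervalIntegral.integral_of_le hab]
  refine integral_congr_ae ?_
  filter_upwards [hf.ae_eq, ae_restrict_mem measurableSet_Ioc] with t ht htab
  have hgt : ∀ᵐ z, g (t, z) = σ t z := by
    filter_upwards [hf.fiberPath_ae_eq hσ hab (Ioc_subset_Icc_self htab)] with z hz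
    rw [hgp t htab z, hz]
  have e1 : ∀ᵐ z, G (t, z) = 1 / 2 * v t z ^ 2 - liftPotential V t (σ t z) - c * v t z := by
    filter_upwards [ht, hgt] with z h1 h2
    simp only [hG, h1, h2]
  have hVt : Integrable (fun z => liftPotential V t (σ t z)) volume := by
    refine Integrable.of_bound ?_ B (ae_of_all _ fun p => hV.bound _ _)
    exact (hV.cont.measurable.comp (measurable_const.prodMk
      (Lp.stronglyMeasurable (σ t)).measurable)).aestronglyMeasurable
  have hsq := (L2I.integrable_sq (v t)).const_mul (1 / 2)
  have e2 := integral_sub (hsq.sub hVt) ((L2I.integrable (v t)).const_mul c)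
  have e3 := integral_sub hsq hVt
  rw [integral_const_mul, L2I.integral_sq] at e3
  rw [integral_congr_ae e1]
  exact e2.trans (congrArg (· - ∫ z, c * v t z) e3)

end Evaluation

/-! ### Regularity and invariance of the energies; constants and integer-valued functions -/

section Potentials

open Topology ENNReal

theorem coe_eq_coe_iff {x y : ℝ} : (x : UnitAddCircle) = y ↔ ∃ n : ℤ, x - y = n := by
  rw [← sub_eq_zero, ← AddCircle.coe_sub, AddCircle.coe_eq_zero_iff]
  simp [eq_comm]

theorem coe_add_intCast (x : ℝ) (n : ℤ) : ((x + n : ℝ) : UnitAddCircle) = x :=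
  coe_eq_coe_iff.2 ⟨n, by ring⟩

theorem exists_bound_of_periodic {F : Type*} [NormedAddCommGroup F] {g : ℝ × ℝ → F}
    (hg : Continuous g) (hper : ∀ (p : ℝ × ℝ) (m n : ℤ), g (p + ((m : ℝ), (n : ℝ))) = g p) :
    ∃ C, 0 ≤ C ∧ ∀ p, ‖g p‖ ≤ C := by
  obtain ⟨C, hC⟩ := ((isCompact_Icc (a := (0 : ℝ)) (b := 1)).prod
    (isCompact_Icc (a := (0 : ℝ)) (b := 1))).exists_bound_of_continuousOn hg.continuousOn
  have h : ∀ p, ‖g p‖ ≤ C := by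
    intro p
    have h1 := hC (Int.fract p.1, Int.fract p.2)
      ⟨⟨Int.fract_nonneg _, (Int.fract_lt_one _).le⟩, ⟨Int.fract_nonneg _, (Int.fract_lt_one _).le⟩⟩
    have h2 := hper (Int.fract p.1, Int.fract p.2) ⌊p.1⌋ ⌊p.2⌋
    rw [Prod.mk_add_mk, Int.fract_add_floor, Int.fract_add_floor] at h2
    rw [← h2] at h1
    exact h1
  exact ⟨C, (norm_nonneg _).trans (h 0), h⟩

/-- The lift and its derivative are continuous and periodic, hence bounded; the mean value
inequality gives the Lipschitz constant. -/
theorem exists_isTame {V : UnitAddCircle × UnitAddCircle → ℝ}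
    (hV : ContDiff ℝ 2 (fun x : ℝ × ℝ => V ((x.1 : UnitAddCircle), (x.2 : UnitAddCircle)))) :
    ∃ B K, 0 ≤ B ∧ 0 ≤ K ∧ IsTame (liftPotential V) B K := by
  set g : ℝ × ℝ → ℝ := fun x => V ((x.1 : UnitAddCircle), (x.2 : UnitAddCircle)) with hg
  have hper : ∀ (p : ℝ × ℝ) (m n : ℤ), g (p + ((m : ℝ), (n : ℝ))) = g p := by
    intro p m n
    simp only [hg, Prod.fst_add, Prod.snd_add, coe_add_intCast]
  obtain ⟨B, hB0, hB⟩ := exists_bound_of_periodic hV.continuous hper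
  obtain ⟨K, hK0, hK⟩ := exists_bound_of_periodic (hV.continuous_fderiv (by norm_num)) (by
    intro p m n
    rw [← fderiv_comp_add_right]
    simp only [hper])
  refine ⟨B, K, hB0, hK0, hV.continuous, fun t x => hB (t, x), fun t x y => ?_⟩
  have := convex_univ.norm_image_sub_le_of_norm_fderiv_le (𝕜 := ℝ) (f := g) (C := K)
    (fun p _ => (hV.differentiable (by norm_num)) p) (fun p _ => hK p) (mem_univ (t, y))
    (mem_univ (t, x))
  simpa [liftPotential, Prod.norm_def] using this

/-- The embedding of the constants in `L²(I)`. -/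
noncomputable def cst : ℝ →L[ℝ] L2I := Lp.constL 2 volume ℝ

theorem coeFn_cst (x : ℝ) : ∀ᵐ z, cst x z = x := Lp.coeFn_const 2 volume x

theorem norm_cst (x : ℝ) : ‖cst x‖ = |x| := by
  have := Lp.norm_const (p := 2) (μ := (volume : Measure Label)) (c := x) (by simp)
  rw [probReal_univ, Real.one_rpow, mul_one] at this
  exact this

theorem inner_cst (x : ℝ) (M : L2I) : inner ℝ (cst x) M = ∫ z, x * M z := by
  rw [L2.inner_def]
  refine integral_congr_ae ?_
  filter_upwards [coeFn_cst x] with z hz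
  simp [hz, mul_comm]

/-- The linear form `N ↦ ∫ c N`. -/
noncomputable def meanForm (c : ℝ) : L2I →L[ℝ] ℝ := innerSL ℝ (cst c)

theorem meanForm_apply (c : ℝ) (N : L2I) : meanForm c N = ∫ z, c * N z := by
  rw [meanForm, innerSL_apply_apply, inner_cst]

/-- The potential energy of a configuration. -/
noncomputable def potentialEnergy (V : UnitAddCircle × UnitAddCircle → ℝ) (W : UnitAddCircle → ℝ)
    (t : ℝ) (M : L2I) : ℝ :=
  externalEnergy V t M + interactionEnergy W M

theorem vlasovLagrangian_eq_tonelli (V : UnitAddCircle × UnitAddCircle → ℝ)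
    (W : UnitAddCircle → ℝ) (c t : ℝ) (M N : L2I) :
    vlasovLagrangian V W c t M N = tonelli (potentialEnergy V W) (meanForm c) t M N := by
  rw [vlasovLagrangian, tonelli, potentialEnergy, meanForm_apply]
  ring

theorem externalEnergy_congr {V : UnitAddCircle × UnitAddCircle → ℝ} {M N : L2I} (t : ℝ)
    (h : ∀ᵐ z, ((M z : ℝ) : UnitAddCircle) = (N z : ℝ)) :
    externalEnergy V t M = externalEnergy V t N := by
  refine integral_congr_ae ?_
  filter_upwards [h] with z hz
  simp only [hz]

theorem interactionEnergy_congr {W : UnitAddCircle → ℝ} {M N : L2I}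
    (h : ∀ᵐ z, ((M z : ℝ) : UnitAddCircle) = (N z : ℝ)) :
    interactionEnergy W M = interactionEnergy W N := by
  rw [interactionEnergy, interactionEnergy]
  congr 1
  refine integral_congr_ae ?_
  filter_upwards [h] with z hz
  refine integral_congr_ae ?_
  filter_upwards [h] with z' hz'
  simp only [AddCircle.coe_sub, hz, hz']

section

variable {V : UnitAddCircle × UnitAddCircle → ℝ} {B K : ℝ} (hV : IsTame (liftPotential V) B K)

include hV

theorem integrable_liftPotential_comp (t : ℝ) (M : L2I) :
    Integrable (fun z => liftPotential V t (M z)) volume := by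
  refine Integrable.of_bound ?_ B (ae_of_all _ fun p => hV.bound _ _)
  exact (hV.cont.measurable.comp (measurable_const.prodMk
    (Lp.stronglyMeasurable M).measurable)).aestronglyMeasurable

theorem externalEnergy_isTame (hK : 0 ≤ K) : IsTame (externalEnergy V) B K := by
  have hint := integrable_liftPotential_comp hV
  have hlip : ∀ t (x y : L2I), |externalEnergy V t x - externalEnergy V t y| ≤ K * ‖x - y‖ := by
    intro t x y
    have h1 : externalEnergy V t x - externalEnergy V t y
        = ∫ z, (liftPotential V t (x z) - liftPotential V t (y z)) :=
      (integral_sub (hint t x) (hint t y)).symm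
    rw [h1]
    refine (abs_integral_le_integral_abs).trans ?_
    calc _ ≤ ∫ z, K * |(x - y) z| := by
          refine integral_mono_ae ((hint t x).sub (hint t y)).norm
            ((L2I.integrable (x - y)).abs.const_mul K) ?_
          filter_upwards [Lp.coeFn_sub x y] with z hz
          rw [hz]; exact hV.lip t _ _
      _ ≤ _ := by
          rw [integral_const_mul]
          exact mul_le_mul_of_nonneg_left (L2I.integral_abs_le _) hK
  refine ⟨?_, ?_, hlip⟩
  -- Joint continuity: uniform Lipschitz bound in M, dominated convergence in t for fixed M.
  · refine continuous_prod_of_continuous_lipschitzWith' _ K.toNNReal (fun t => ?_) (fun M => ?_)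
    rotate_left
    · refine continuous_of_dominated (bound := fun _ => B)
        (fun t => (hint t M).aestronglyMeasurable) (fun t => ae_of_all _ fun z => hV.bound _ _)
        (integrable_const _) (ae_of_all _ fun z => ?_)
      exact hV.cont.comp (continuous_id.prodMk (continuous_const (y := M z)))
    · refine LipschitzWith.of_dist_le_mul fun x y => ?_
      rw [Real.coe_toNNReal _ hK, dist_eq_norm, dist_eq_norm]
      exact hlip t x y
  · intro t M
    refine (abs_integral_le_integral_abs).trans ?_
    calc _ ≤ ∫ _ : Label, B := integral_mono (hint t M).norm (integrable_const _)
          fun z => hV.bound _ _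
      _ = B := by simp

end

section

variable {W : UnitAddCircle → ℝ} {B K : ℝ} (hW : IsTame (liftPotential fun p => W p.2) B K)

include hW

theorem integrable_interaction (M : L2I) :
    Integrable (fun p : Label × Label => W ((M p.1 - M p.2 : ℝ) : UnitAddCircle))
      (volume.prod volume) := by
  refine Integrable.of_bound ?_ B (ae_of_all _ fun p => hW.bound 0 _)
  have hM := (Lp.stronglyMeasurable M).measurable
  exact (hW.cont.measurable.comp (measurable_const (a := (0 : ℝ)).prodMk
    ((hM.comp measurable_fst).sub (hM.comp measurable_snd)))).aestronglyMeasurable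

theorem interactionEnergy_eq_integral_prod (M : L2I) :
    interactionEnergy W M = 1 / 2 * ∫ p : Label × Label,
      W ((M p.1 - M p.2 : ℝ) : UnitAddCircle) ∂(volume.prod volume) := by
  rw [interactionEnergy, integral_prod _ (integrable_interaction hW M)]

/-- The difference at (z, z') is controlled by |M - N| at z plus at z'; the factor 1/2 absorbs these
two contributions. -/
theorem interactionEnergy_lip (hK : 0 ≤ K) (M N : L2I) :
    |interactionEnergy W M - interactionEnergy W N| ≤ K * ‖M - N‖ := by
  rw [interactionEnergy_eq_integral_prod hW, interactionEnergy_eq_integral_prod hW, ← mul_sub,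
    ← integral_sub (integrable_interaction hW M) (integrable_interaction hW N), abs_mul,
    abs_of_pos (by norm_num : (0 : ℝ) < 1 / 2)]
  have hi := L2I.integrable (M - N)
  have h1 : Integrable (fun p : Label × Label => |(M - N) p.1|) (volume.prod volume) :=
    (hi.comp_fst volume).abs
  have h2 : Integrable (fun p : Label × Label => |(M - N) p.2|) (volume.prod volume) :=
    (hi.comp_snd volume).abs
  have h3 : ∫ p : Label × Label, |(M - N) p.1| ∂(volume.prod volume) ≤ ‖M - N‖ := by
    have := integral_fun_fst (μ := (volume : Measure Label)) (ν := (volume : Measure Label))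
      (fun z => |(M - N) z|)
    rw [this]; simpa using L2I.integral_abs_le (M - N)
  have h4 : ∫ p : Label × Label, |(M - N) p.2| ∂(volume.prod volume) ≤ ‖M - N‖ := by
    have := integral_fun_snd (μ := (volume : Measure Label)) (ν := (volume : Measure Label))
      (fun z => |(M - N) z|)
    rw [this]; simpa using L2I.integral_abs_le (M - N)
  have h5 : |∫ p : Label × Label, (W ((M p.1 - M p.2 : ℝ) : UnitAddCircle)
      - W ((N p.1 - N p.2 : ℝ) : UnitAddCircle)) ∂(volume.prod volume)|
      ≤ ∫ p : Label × Label, K * (|(M - N) p.1| + |(M - N) p.2|) ∂(volume.prod volume) := by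
    refine (abs_integral_le_integral_abs).trans (integral_mono_ae
      ((integrable_interaction hW M).sub (integrable_interaction hW N)).norm
      ((h1.add h2).const_mul K) ?_)
    have hs := Lp.coeFn_sub M N
    filter_upwards [Measure.quasiMeasurePreserving_fst.ae hs,
      Measure.quasiMeasurePreserving_snd.ae hs] with p hp1 hp2
    simp only [Pi.sub_apply] at hp1 hp2
    rw [hp1, hp2]
    refine (hW.lip 0 _ _).trans (mul_le_mul_of_nonneg_left ?_ hK)
    rw [Real.norm_eq_abs, show M p.1 - M p.2 - (N p.1 - N p.2)
      = (M p.1 - N p.1) - (M p.2 - N p.2) by ring]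
    exact abs_sub _ _
  rw [integral_const_mul, integral_add h1 h2] at h5
  have := mul_le_mul_of_nonneg_left (add_le_add h3 h4) hK
  linarith

theorem interactionEnergy_bound (M : L2I) : |interactionEnergy W M| ≤ B := by
  rw [interactionEnergy_eq_integral_prod hW, abs_mul, abs_of_pos (by norm_num : (0 : ℝ) < 1 / 2)]
  have hB : 0 ≤ B := (abs_nonneg _).trans (hW.bound 0 0)
  have : |∫ p : Label × Label, W ((M p.1 - M p.2 : ℝ) : UnitAddCircle) ∂(volume.prod volume)|
      ≤ B := by
    refine (abs_integral_le_integral_abs).trans ?_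
    calc _ ≤ ∫ _ : Label × Label, B ∂(volume.prod volume) :=
          integral_mono (integrable_interaction hW M).norm (integrable_const _)
            fun p => hW.bound 0 _
      _ = B := by simp
  linarith

theorem continuous_interactionEnergy (hK : 0 ≤ K) : Continuous (interactionEnergy W) := by
  refine (LipschitzWith.of_dist_le_mul (K := K.toNNReal) fun x y => ?_).continuous
  rw [Real.coe_toNNReal _ hK, dist_eq_norm, dist_eq_norm]
  exact interactionEnergy_lip hW hK x y

end

theorem potentialEnergy_isTame {V : UnitAddCircle × UnitAddCircle → ℝ} {W : UnitAddCircle → ℝ}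
    {B K B' K' : ℝ} (hV : IsTame (liftPotential V) B K)
    (hW : IsTame (liftPotential fun p => W p.2) B' K') (hK : 0 ≤ K) (hK' : 0 ≤ K') :
    IsTame (potentialEnergy V W) (B + B') (K + K') := by
  have h := externalEnergy_isTame hV hK
  refine ⟨h.cont.add ((continuous_interactionEnergy hW hK').comp continuous_snd), ?_, ?_⟩
  · intro t M
    exact (abs_add_le _ _).trans (add_le_add (h.bound t M) (interactionEnergy_bound hW M))
  · intro t M N
    rw [potentialEnergy, potentialEnergy, add_sub_add_comm, add_mul]
    exact (abs_add_le _ _).trans (add_le_add (h.lip t M N) (interactionEnergy_lip hW hK' M N))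

theorem externalEnergy_cst (V : UnitAddCircle × UnitAddCircle → ℝ) (t x : ℝ) :
    externalEnergy V t (cst x) = liftPotential V t x := by
  have : externalEnergy V t (cst x) = ∫ _ : Label, liftPotential V t x := by
    refine integral_congr_ae ?_
    filter_upwards [coeFn_cst x] with z hz
    rw [hz]; rfl
  rw [this]; simp

theorem interactionEnergy_cst {W : UnitAddCircle → ℝ} (hW0 : W 0 = 0) (x : ℝ) :
    interactionEnergy W (cst x) = 0 := by
  have : ∫ z : Label, ∫ z' : Label, W ((cst x z - cst x z' : ℝ) : UnitAddCircle)
      = ∫ _ : Label, (0 : ℝ) := by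
    refine integral_congr_ae ?_
    filter_upwards [coeFn_cst x] with z hz
    have : ∫ z' : Label, W ((cst x z - cst x z' : ℝ) : UnitAddCircle) = ∫ _ : Label, (0 : ℝ) := by
      refine integral_congr_ae ?_
      filter_upwards [coeFn_cst x] with z' hz'
      rw [hz, hz', sub_self]; exact hW0
    rw [this]; simp
  rw [interactionEnergy, this]; simp

/-- Particles moving together do not interact and I has measure 1, so particle dynamics embeds
isometrically as constants. -/
theorem tonelli_cst (V : UnitAddCircle × UnitAddCircle → ℝ) {W : UnitAddCircle → ℝ}
    (hW0 : W 0 = 0) (c t x p : ℝ) :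
    tonelli (potentialEnergy V W) (meanForm c) t (cst x) (cst p)
      = particleLagrangian V c t x p := by
  have h : meanForm c (cst p) = c * p := by
    rw [meanForm, innerSL_apply_apply, inner_cst]
    have : ∫ z, c * cst p z = ∫ _ : Label, c * p :=
      integral_congr_ae ((coeFn_cst p).mono fun z hz => by simp [hz])
    rw [this]; simp
  rw [tonelli, potentialEnergy, externalEnergy_cst, interactionEnergy_cst hW0, norm_cst, sq_abs, h]
  simp [particleLagrangian, liftPotential]

theorem zero_mem_L2Z : (0 : L2I) ∈ L2Z :=
  ae_of_all _ fun z => ⟨0, by simp⟩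

theorem mem_L2Z_iff_coe {M : L2I} : M ∈ L2Z ↔ ∀ᵐ z, ((M z : ℝ) : UnitAddCircle) = 0 := by
  refine eventually_congr (ae_of_all _ fun z => ?_)
  have := coe_eq_coe_iff (x := M z) (y := 0)
  simpa using this.symm

theorem sub_mem_L2Z_iff {M N : L2I} :
    M - N ∈ L2Z ↔ ∀ᵐ z, ((M z : ℝ) : UnitAddCircle) = (N z : ℝ) := by
  rw [mem_L2Z_iff_coe]
  refine eventually_congr ?_
  filter_upwards [Lp.coeFn_sub M N] with z hz
  rw [hz, Pi.sub_apply, AddCircle.coe_sub, sub_eq_zero]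

theorem neg_mem_L2Z {Z : L2I} (h : Z ∈ L2Z) : -Z ∈ L2Z := by
  filter_upwards [h, Lp.coeFn_neg Z] with z ⟨n, hn⟩ h2
  exact ⟨-n, by rw [h2, Pi.neg_apply, hn]; simp⟩

theorem coe_add_of_mem_L2Z (M : L2I) {Z : L2I} (h : Z ∈ L2Z) :
    ∀ᵐ z, (((M + Z) z : ℝ) : UnitAddCircle) = (M z : ℝ) := by
  rw [← sub_mem_L2Z_iff, add_sub_cancel_left]; exact h

theorem exists_L2Z_round (M : L2I) :
    ∃ Z ∈ L2Z, ∀ᵐ z, (M - Z) z = M z - round (M z) := by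
  have hm : Measurable fun z => ((round (M z) : ℤ) : ℝ) := by
    simp only [round_eq]
    exact (measurable_from_top (f := fun n : ℤ => (n : ℝ))).comp
      (Int.measurable_floor.comp ((Lp.stronglyMeasurable M).measurable.add_const _))
  have hL : MemLp (fun z => ((round (M z) : ℤ) : ℝ)) 2 (volume : Measure Label) := by
    refine ((Lp.memLp M).norm.add (memLp_const (1 / 2 : ℝ))).mono hm.aestronglyMeasurable
      (ae_of_all _ fun z => ?_)
    have h1 := abs_sub_round (M z)
    have h2 : |((round (M z) : ℤ) : ℝ)| ≤ |M z| + 1 / 2 := by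
      have := abs_sub_abs_le_abs_sub ((round (M z) : ℤ) : ℝ) (M z)
      rw [abs_sub_comm] at this
      linarith
    simp only [Pi.add_apply, Real.norm_eq_abs]
    exact h2.trans (le_abs_self _)
  refine ⟨hL.toLp _, ?_, ?_⟩
  · filter_upwards [hL.coeFn_toLp] with z hz
    exact ⟨_, hz⟩
  · filter_upwards [hL.coeFn_toLp, Lp.coeFn_sub M (hL.toLp _)] with z h1 h2
    rw [h2, Pi.sub_apply, h1]

/-- The quotient 𝐓 has bounded diameter, which gives uniform upper bounds for unit-time actions. -/
theorem exists_L2Z_near (M : L2I) : ∃ Z ∈ L2Z, ‖M - Z‖ ≤ 1 := by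
  obtain ⟨Z, hZ, h⟩ := exists_L2Z_round M
  refine ⟨Z, hZ, ?_⟩
  have := Lp.norm_le_of_ae_bound (f := M - Z) (C := 1) zero_le_one (by
    filter_upwards [h] with z hz
    rw [hz, Real.norm_eq_abs]
    linarith [abs_sub_round (M z)])
  simpa [measureUnivNNReal] using this

end Potentials

/-! ### Eigenfunctions of min-plus operators on a compact space -/

section Eigenfunction

open Topology BoundedContinuousFunction

variable {X : Type*} [MetricSpace X] [CompactSpace X] [Nonempty X]

/-- The min-plus operator of a bounded kernel which is Lipschitz in its first variable has an
eigenfunction. -/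
theorem exists_minPlus_eigenfunction {k : X → X → ℝ} {B C : ℝ} (hB : ∀ x y, |k x y| ≤ B)
    (hC : ∀ x x' y, k x y ≤ k x' y + C * dist x x') (hC0 : 0 ≤ C) :
    ∃ (α : ℝ) (u : X → ℝ), Continuous u ∧
      (∀ x y, u x ≤ α + (k x y + u y)) ∧ ∀ x, ∀ ε > 0, ∃ y, α + (k x y + u y) < u x + ε := by
  have hbdd : ∀ (f : X →ᵇ ℝ) x, BddBelow (range fun y => k x y + f y) := by
    intro f x
    refine ⟨-B - ‖f‖, ?_⟩
    rintro _ ⟨y, rfl⟩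
    have h1 := (abs_le.1 (hB x y)).1
    have h2 := (abs_le.1 (f.norm_coe_le_norm y)).1
    simp only; linarith
  have hLip : ∀ f : X →ᵇ ℝ, LipschitzWith C.toNNReal (fun x => ⨅ y, (k x y + f y)) := by
    intro f
    refine LipschitzWith.of_le_add_mul _ fun x x' => ?_
    rw [Real.coe_toNNReal _ hC0, ← sub_le_iff_le_add]
    refine le_ciInf fun y => ?_
    have := ciInf_le (hbdd f x) y
    linarith [hC x x' y]
  let T : (X →ᵇ ℝ) → (X →ᵇ ℝ) := fun f => mkOfCompact ⟨_, (hLip f).continuous⟩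
  have hT : ∀ f x, T f x = ⨅ y, (k x y + f y) := fun f x => rfl
  have hTle : ∀ f g : X →ᵇ ℝ, ∀ x, T f x ≤ T g x + dist f g := by
    intro f g x
    rw [hT, hT, ← sub_le_iff_le_add]
    refine le_ciInf fun y => ?_
    have h1 := ciInf_le (hbdd f x) y
    have h2 := (abs_le.1 ((Real.dist_eq _ _).symm.trans_le (f.dist_coe_le_dist (g := g) y))).2
    linarith
  have hTlip : LipschitzWith 1 T := by
    refine LipschitzWith.of_dist_le_mul fun f g => ?_
    rw [NNReal.coe_one, one_mul, dist_le dist_nonneg]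
    intro x
    rw [Real.dist_eq, abs_le]
    have h1 := hTle f g x
    have h2 := hTle g f x
    rw [dist_comm g f] at h2
    constructor <;> linarith
  have hTconst : ∀ (f : X →ᵇ ℝ) (r : ℝ), T (f + const X r) = T f + const X r := by
    intro f r
    ext x
    simp only [hT, BoundedContinuousFunction.add_apply, const_apply, ← add_assoc]
    rw [ciInf_add (hbdd f x)]
  have hTbd : ∀ f : X →ᵇ ℝ, ‖T f‖ ≤ B + ‖f‖ := by
    intro f
    have hB0 : 0 ≤ B := (abs_nonneg _).trans (hB (Classical.arbitrary X) (Classical.arbitrary X))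
    rw [norm_le (by positivity)]
    intro x
    rw [Real.norm_eq_abs, abs_le, hT]
    constructor
    · refine le_ciInf fun y => ?_
      have h1 := (abs_le.1 (hB x y)).1
      have h2 := (abs_le.1 (f.norm_coe_le_norm y)).1
      linarith
    · refine (ciInf_le (hbdd f x) x).trans ?_
      have h1 := (abs_le.1 (hB x x)).2
      have h2 := (abs_le.1 (f.norm_coe_le_norm x)).2
      linarith
  -- Vanishing discount: T is nonexpansive, so f ↦ T (l f) is a contraction for l < 1; l then tends
  -- to 1.
  set l : ℕ → ℝ := fun n => 1 - 1 / ((n : ℝ) + 1) with hl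
  have hl0 : ∀ n, 0 ≤ l n ∧ l n < 1 := by
    intro n
    have h1 : (0 : ℝ) < (n : ℝ) + 1 := by positivity
    have h2 : 1 / ((n : ℝ) + 1) ≤ 1 := by rw [div_le_one h1]; linarith [(n.cast_nonneg : (0 : ℝ) ≤ n)]
    have h3 : 0 < 1 / ((n : ℝ) + 1) := by positivity
    constructor <;> simp only [hl] <;> linarith
  have hcontr : ∀ n, ContractingWith (l n).toNNReal (fun f : X →ᵇ ℝ => T (l n • f)) := by
    intro n
    refine ⟨?_, LipschitzWith.of_dist_le_mul fun f g => ?_⟩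
    · rw [← NNReal.coe_lt_coe, Real.coe_toNNReal _ (hl0 n).1]; exact (hl0 n).2
    · refine (hTlip.dist_le_mul _ _).trans ?_
      have h1 : l n • f - l n • g = l n • (f - g) := by ext x; simp; ring
      rw [NNReal.coe_one, one_mul, dist_eq_norm, h1, norm_smul, dist_eq_norm,
        Real.coe_toNNReal _ (hl0 n).1, Real.norm_eq_abs, abs_of_nonneg (hl0 n).1]
  choose F hF using fun n => (⟨_, (hcontr n).fixedPoint_isFixedPt⟩ :
    ∃ f : X →ᵇ ℝ, T (l n • f) = f)
  let x₀ : X := Classical.arbitrary X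
  -- The discounted fixed points may be unbounded as l → 1. Normalised at x₀, they stay in a compact
  -- set by Arzelà–Ascoli, and the constants removed leave a bounded drift s, whose limit is -α.
  let g : ℕ → (X →ᵇ ℝ) := fun n => F n - const X (F n x₀)
  let s : ℕ → ℝ := fun n => (1 - l n) * F n x₀
  have hg : ∀ n, T (l n • g n) = g n + const X (s n) := by
    intro n
    have h1 : l n • g n = l n • F n + const X (-(l n * F n x₀)) := by
      ext x; simp [g]; ring
    rw [h1, hTconst, hF]
    ext x; simp [g, s]; ring
  have hs : ∀ n, s n ∈ Icc (-B) B := by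
    intro n
    have h1 : ‖F n‖ ≤ B + l n * ‖F n‖ := by
      have := hTbd (l n • F n)
      rwa [hF, norm_smul, Real.norm_eq_abs, abs_of_nonneg (hl0 n).1] at this
    have h2 := (F n).norm_coe_le_norm x₀
    change _ ≤ (1 - l n) * F n x₀ ∧ (1 - l n) * F n x₀ ≤ _
    rw [← abs_le, abs_mul, abs_of_nonneg (by linarith [(hl0 n).2])]
    have := mul_le_mul_of_nonneg_left h2 (by linarith [(hl0 n).2] : 0 ≤ 1 - l n)
    rw [Real.norm_eq_abs] at this
    linarith
  have hgLip : ∀ n, LipschitzWith C.toNNReal (g n) := by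
    intro n
    have h1 : LipschitzWith C.toNNReal (F n) := by
      rw [← hF n]; exact hLip _
    refine LipschitzWith.of_dist_le_mul fun x y => ?_
    simpa [g] using h1.dist_le_mul x y
  let A : Set (X →ᵇ ℝ) := {f | LipschitzWith C.toNNReal f ∧
    ∀ x, f x ∈ Icc (-(C * Metric.diam (univ : Set X))) (C * Metric.diam (univ : Set X))}
  have hAc : IsCompact A := by
    refine arzela_ascoli₂ _ isCompact_Icc A ?_ (fun f x hf => hf.2 x) ?_
    · have : A = (⋂ x, ⋂ y, {f : X →ᵇ ℝ | dist (f x) (f y) ≤ C.toNNReal * dist x y}) ∩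
          ⋂ x, {f : X →ᵇ ℝ | f x ∈ Icc (-(C * Metric.diam (univ : Set X)))
            (C * Metric.diam (univ : Set X))} := by
        ext f
        simp [A, lipschitzWith_iff_dist_le_mul]
      rw [this]
      refine IsClosed.inter (isClosed_iInter fun x => isClosed_iInter fun y => ?_)
        (isClosed_iInter fun x => ?_)
      · exact isClosed_le ((continuous_eval_const x).dist (continuous_eval_const y))
          continuous_const
      · exact isClosed_Icc.preimage (continuous_eval_const x)
    · exact (LipschitzWith.uniformEquicontinuous (fun f : A => ((f : X →ᵇ ℝ) : X → ℝ)) C.toNNReal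
        fun f => f.2.1).equicontinuous
  have hgA : ∀ n, g n ∈ A := by
    intro n
    refine ⟨hgLip n, fun x => ?_⟩
    have h1 := (hgLip n).dist_le_mul x x₀
    have h2 : g n x₀ = 0 := by simp [g]
    rw [h2, Real.dist_0_eq_abs, Real.coe_toNNReal _ hC0] at h1
    rw [mem_Icc, ← abs_le]
    refine h1.trans (mul_le_mul_of_nonneg_left ?_ hC0)
    exact Metric.dist_le_diam_of_mem (Metric.isBounded_of_compactSpace) (mem_univ _) (mem_univ _)
  obtain ⟨⟨u, r⟩, -, φ, hφ, hlim⟩ := (hAc.prod (isCompact_Icc (a := -B) (b := B))).tendsto_subseq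
    (fun n => (⟨hgA n, hs n⟩ : (g n, s n) ∈ A ×ˢ Icc (-B) B))
  have hu : Tendsto (fun n => g (φ n)) atTop (𝓝 u) := (continuous_fst.tendsto _).comp hlim
  have hr : Tendsto (fun n => s (φ n)) atTop (𝓝 r) := (continuous_snd.tendsto _).comp hlim
  have hl1 : Tendsto (fun n => l (φ n)) atTop (𝓝 1) := by
    have := (tendsto_one_div_add_atTop_nhds_zero_nat (𝕜 := ℝ)).const_sub 1
    rw [sub_zero] at this
    exact this.comp hφ.tendsto_atTop
  have hlim1 : Tendsto (fun n => T (l (φ n) • g (φ n))) atTop (𝓝 (T u)) := by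
    have := hl1.smul hu
    rw [one_smul] at this
    exact (hTlip.continuous.tendsto u).comp this
  have hfix : ∀ x, T u x = u x + r := by
    intro x
    have h1 : Tendsto (fun n => T (l (φ n) • g (φ n)) x) atTop (𝓝 (T u x)) :=
      ((continuous_eval_const x).tendsto _).comp hlim1
    have h2 : Tendsto (fun n => g (φ n) x + s (φ n)) atTop (𝓝 (u x + r)) :=
      (((continuous_eval_const x).tendsto _).comp hu).add hr
    refine tendsto_nhds_unique h1 (h2.congr fun n => ?_)
    rw [hg]; rfl
  refine ⟨-r, u, u.continuous, fun x y => ?_, fun x ε hε => ?_⟩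
  · have := ciInf_le (hbdd u x) y
    rw [← hT, hfix] at this
    linarith
  · have h1 : ⨅ y, (k x y + u y) < u x + r + ε := by rw [← hT, hfix]; linarith
    obtain ⟨y, hy⟩ := exists_lt_of_ciInf_lt h1
    exact ⟨y, by linarith⟩

end Eigenfunction

/-! ### Weak KAM theory for one particle -/

section ParticleKAM

open Topology

/-- Moving the origin of a curve of bounded action. -/
theorem IsTame.exists_move_start {E : Type*} [NormedAddCommGroup E] [InnerProductSpace ℝ E]
    [CompleteSpace E] {P : ℝ → E → ℝ} {B K : ℝ} (hP : IsTame P B K) (hK : 0 ≤ K)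
    (ℓ : E →L[ℝ] ℝ) (R : ℝ) :
    ∃ C, 0 ≤ C ∧ ∀ (γ w : ℝ → E), HasACDeriv (Icc 0 1) γ w →
      IntervalIntegrable (fun t => ‖w t‖ ^ 2) volume 0 1 →
      ∫ t in (0 : ℝ)..1, tonelli P ℓ t (γ t) (w t) ≤ R → ∀ h : E, ‖h‖ ≤ 1 →
      ∃ γ' w' : ℝ → E, HasACDeriv (Icc 0 1) γ' w' ∧
        IntervalIntegrable (fun t => ‖w' t‖ ^ 2) volume 0 1 ∧ γ' 0 = γ 0 + h ∧ γ' 1 = γ 1 ∧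
        ∫ t in (0 : ℝ)..1, tonelli P ℓ t (γ' t) (w' t) ≤
          (∫ t in (0 : ℝ)..1, tonelli P ℓ t (γ t) (w t)) + C * ‖h‖ := by
  have hB : 0 ≤ B := (abs_nonneg _).trans (hP.bound 0 0)
  -- Action at most R bounds the kinetic integral by 4(|R| + B + ‖ℓ‖²), hence the displacement by
  -- half of this plus 1/2. The other 1/2 comes from ‖h‖² ≤ ‖h‖.
  refine ⟨2 * (|R| + B + ‖ℓ‖ ^ 2) + 1 + K + ‖ℓ‖, by positivity, ?_⟩
  intro γ w hγ h2 hR h hh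
  have hφ1 : ∀ t ∈ Icc (0 : ℝ) 1, |1 + (-1) * max 0 (min t (0 + 1) - 0)|
      ≤ (Icc (0 : ℝ) (0 + 1)).indicator (fun _ => (1 : ℝ)) t := by
    intro t ht
    rw [zero_add, indicator_of_mem ht, min_eq_left ht.2, max_eq_right (by linarith [ht.1]), abs_le]
    constructor <;> linarith [ht.1, ht.2]
  obtain ⟨w', h1, h3, h4⟩ := hP.action_perturb_le ℓ hγ zero_le_one hK h2 le_rfl (by simp)
    (by norm_num : (-1 : ℝ) ^ 2 = 1) (φ₀ := 1) (fun t => rfl) hφ1 h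
  refine ⟨_, w', h1, h3, by simp, by simp, h4.trans ?_⟩
  have h5 := hP.integral_sq_le ℓ hγ zero_le_one h2
  have h6 := hγ.norm_sub_le zero_le_one h2 le_rfl zero_le_one le_rfl
  have h7 : |inner ℝ (γ 1 - γ 0) h| ≤ (2 * (|R| + B + ‖ℓ‖ ^ 2) + 1 / 2) * ‖h‖ := by
    refine (abs_real_inner_le_norm _ _).trans (mul_le_mul_of_nonneg_right ?_ (norm_nonneg _))
    linarith [le_abs_self R]
  have h8 := (abs_le.1 h7).1
  have h9 : ‖h‖ ^ 2 ≤ ‖h‖ := by nlinarith [norm_nonneg h]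
  rw [zero_add]
  nlinarith

variable {V : UnitAddCircle × UnitAddCircle → ℝ} {B K : ℝ}

/-- The weak KAM theorem for a particle on the circle. -/
theorem exists_particle_weakKAM (hP : IsTame (liftPotential V) B K) (hK : 0 ≤ K)
    (ℓ : ℝ →L[ℝ] ℝ) :
    ∃ (α : ℝ) (u : UnitAddCircle → ℝ), Continuous u ∧
      (∀ γ w : ℝ → ℝ, HasACDeriv (Icc 0 1) γ w →
        IntervalIntegrable (fun t => ‖w t‖ ^ 2) volume 0 1 →
        u (γ 0 : ℝ) ≤ α + ((∫ t in (0 : ℝ)..1, tonelli (liftPotential V) ℓ t (γ t) (w t))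
          + u (γ 1 : ℝ))) ∧
      ∀ x : UnitAddCircle, ∀ ε > 0, ∃ γ w : ℝ → ℝ, HasACDeriv (Icc 0 1) γ w ∧
        IntervalIntegrable (fun t => ‖w t‖ ^ 2) volume 0 1 ∧ (γ 0 : UnitAddCircle) = x ∧
        α + ((∫ t in (0 : ℝ)..1, tonelli (liftPotential V) ℓ t (γ t) (w t))
          + u (γ 1 : ℝ)) < u x + ε := by
  have hB : 0 ≤ B := (abs_nonneg _).trans (hP.bound 0 0)
  have hlift : ∀ x : UnitAddCircle, ∃ a : ℝ, (a : UnitAddCircle) = x ∧ |a| = ‖x‖ := by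
    intro x
    obtain ⟨a, rfl⟩ := QuotientAddGroup.mk_surjective x
    refine ⟨a - round a, coe_eq_coe_iff.2 ⟨-round a, by push_cast; ring⟩, ?_⟩
    exact (UnitAddCircle.norm_eq).symm
  have hnorm : ∀ x : UnitAddCircle, ‖x‖ ≤ 1 := by
    intro x
    have := AddCircle.norm_le_half_period (1 : ℝ) one_ne_zero (x := x)
    rw [abs_one] at this
    linarith
  set Adm : UnitAddCircle → UnitAddCircle → Set ℝ := fun x y => {r | ∃ γ w : ℝ → ℝ,
    HasACDeriv (Icc 0 1) γ w ∧ IntervalIntegrable (fun t => ‖w t‖ ^ 2) volume 0 1 ∧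
    (γ 0 : UnitAddCircle) = x ∧ (γ 1 : UnitAddCircle) = y ∧
    r = ∫ t in (0 : ℝ)..1, tonelli (liftPotential V) ℓ t (γ t) (w t)} with hAdm
  have hlow : ∀ x y, ∀ r ∈ Adm x y, -(B + ‖ℓ‖ ^ 2) ≤ r := by
    rintro x y r ⟨γ, w, h1, h2, -, -, rfl⟩
    have h3 := hP.integral_sq_le ℓ h1 zero_le_one h2
    have h4 : 0 ≤ ∫ t in (0 : ℝ)..1, ‖w t‖ ^ 2 :=
      intervalIntegral.integral_nonneg zero_le_one fun t _ => by positivity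
    linarith
  set R : ℝ := 1 / 2 + B + ‖ℓ‖ with hR
  have hupp : ∀ x y, ∃ r ∈ Adm x y, r ≤ R := by
    intro x y
    obtain ⟨a, ha, -⟩ := hlift x
    obtain ⟨b, hb, hb'⟩ := hlift (y - x)
    have hb1 : |b| ≤ 1 := hb'.trans_le (hnorm _)
    refine ⟨_, ⟨_, _, hasACDeriv_affine zero_le_one a b, intervalIntegrable_const, ?_, ?_, rfl⟩, ?_⟩
    · simpa using ha
    · simp [ha, hb]
    · have := hP.integral_affine_le ℓ 0 a b
      rw [zero_add] at this
      refine this.trans ?_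
      rw [Real.norm_eq_abs]
      have h1 : |b| ^ 2 ≤ 1 := by nlinarith [abs_nonneg b]
      have h2 : ‖ℓ‖ * |b| ≤ ‖ℓ‖ := mul_le_of_le_one_right (norm_nonneg _) hb1
      linarith
  have hbd : ∀ x y, BddBelow (Adm x y) := fun x y => ⟨_, fun r hr => hlow x y r hr⟩
  have hne : ∀ x y, (Adm x y).Nonempty := fun x y => by
    obtain ⟨r, hr, -⟩ := hupp x y; exact ⟨r, hr⟩
  have hkR : ∀ x y, sInf (Adm x y) ≤ R := fun x y => by
    obtain ⟨r, hr, h⟩ := hupp x y; exact (csInf_le (hbd x y) hr).trans h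
  obtain ⟨C, hC0, hC⟩ := hP.exists_move_start hK ℓ (R + 1)
  obtain ⟨α, u, hu, hdom, hcal⟩ := exists_minPlus_eigenfunction
    (k := fun x y => sInf (Adm x y)) (B := max (B + ‖ℓ‖ ^ 2) R) (C := C) (fun x y => by
      rw [abs_le]
      exact ⟨(neg_le_neg (le_max_left _ _)).trans (le_csInf (hne x y) (hlow x y)),
        (hkR x y).trans (le_max_right _ _)⟩) (fun x x' y => by
      refine le_of_forall_pos_lt_add fun ε hε => ?_
      obtain ⟨r, ⟨γ, w, h1, h2, h3, h4, rfl⟩, hr⟩ := exists_lt_of_csInf_lt (hne x' y)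
        -- Capping the error at 1 keeps the action below R + 1, so that C does not depend on ε.
        (lt_add_of_pos_right _ (lt_min hε one_pos) : sInf (Adm x' y) < sInf (Adm x' y) + min ε 1)
      obtain ⟨d, hd, hd'⟩ := hlift (x - x')
      have hd1 : ‖d‖ ≤ 1 := hd'.trans_le (hnorm _)
      obtain ⟨γ', w', e1, e2, e3, e4, e5⟩ := hC γ w h1 h2
        (by linarith [hkR x' y, min_le_right ε 1]) d hd1
      have hmem : (∫ t in (0 : ℝ)..1, tonelli (liftPotential V) ℓ t (γ' t) (w' t)) ∈ Adm x y :=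
        ⟨γ', w', e1, e2, by rw [e3, AddCircle.coe_add, h3, hd]; abel, by rw [e4, h4], rfl⟩
      have h5 := csInf_le (hbd x y) hmem
      rw [Real.norm_eq_abs, hd', ← dist_eq_norm] at e5
      linarith [min_le_left ε 1]) hC0
  refine ⟨α, u, hu, fun γ w h1 h2 => ?_, fun x ε hε => ?_⟩
  · have h3 := csInf_le (hbd (γ 0) (γ 1)) ⟨γ, w, h1, h2, rfl, rfl, rfl⟩
    linarith [hdom (γ 0) (γ 1)]
  · obtain ⟨y, hy⟩ := hcal x (ε / 2) (half_pos hε)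
    obtain ⟨r, ⟨γ, w, h1, h2, h3, h4, rfl⟩, hr⟩ := exists_lt_of_csInf_lt (hne x y)
      (lt_add_of_pos_right _ (half_pos hε) : sInf (Adm x y) < sInf (Adm x y) + ε / 2)
    refine ⟨γ, w, h1, h2, h3, ?_⟩
    rw [h4]
    linarith

end ParticleKAM

/-! ### Averaging a dominated function over the particles -/

section LiftedDomination

open Topology

theorem extIntegral_of_intervalIntegrable {f : ℝ → ℝ} {a b : ℝ}
    (h : IntervalIntegrable f volume a b) :
    extIntegral f a b = ((∫ t in a..b, f t : ℝ) : EReal) := if_pos h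

theorem extIntegral_of_not {f : ℝ → ℝ} {a b : ℝ}
    (h : ¬ IntervalIntegrable f volume a b) : extIntegral f a b = ⊤ := if_neg h

theorem exists_abs_le_of_continuous {u : UnitAddCircle → ℝ} (hu : Continuous u) :
    ∃ C, 0 ≤ C ∧ ∀ x, |u x| ≤ C := by
  obtain ⟨C, hC⟩ := isCompact_univ.exists_bound_of_continuousOn hu.continuousOn
  exact ⟨C, (norm_nonneg _).trans (hC 0 (mem_univ _)), fun x => hC x (mem_univ _)⟩

theorem integrable_circle_comp {u : UnitAddCircle → ℝ} (hu : Continuous u) (M : L2I) :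
    Integrable (fun z => u (M z : ℝ)) volume := by
  obtain ⟨C, -, hC⟩ := exists_abs_le_of_continuous hu
  refine Integrable.of_bound ?_ C (ae_of_all _ fun z => hC _)
  exact ((hu.comp (AddCircle.continuous_mk' 1)).measurable.comp
    (Lp.stronglyMeasurable M).measurable).aestronglyMeasurable

theorem abs_integral_circle_comp_le {u : UnitAddCircle → ℝ} (hu : Continuous u) {C : ℝ}
    (hC : ∀ x, |u x| ≤ C) (M : L2I) : |∫ z, u (M z : ℝ)| ≤ C := by
  refine abs_integral_le_integral_abs.trans ?_
  calc _ ≤ ∫ _ : Label, C := integral_mono (integrable_circle_comp hu M).abs (integrable_const _)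
        fun z => hC _
    _ = C := by simp

variable {V : UnitAddCircle × UnitAddCircle → ℝ} {W : UnitAddCircle → ℝ} {B K B' K' : ℝ}

/-- A function on the circle dominated by the particle Lagrangian induces a function on `L²(I)`
dominated by the Vlasov Lagrangian without interaction. -/
theorem lift_domination (hV : IsTame (liftPotential V) B K) (hK : 0 ≤ K)
    (hW : IsTame (liftPotential fun p => W p.2) B' K') (hK' : 0 ≤ K') {c α : ℝ}
    {u : UnitAddCircle → ℝ} (hu : Continuous u)
    (hdom : ∀ γ w : ℝ → ℝ, HasACDeriv (Icc 0 1) γ w →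
      IntervalIntegrable (fun t => ‖w t‖ ^ 2) volume 0 1 →
      u (γ 0 : ℝ) ≤ α + ((∫ t in (0 : ℝ)..1, particleLagrangian V c t (γ t : ℝ) (w t))
        + u (γ 1 : ℝ))) {σ v : ℝ → L2I} (hσ : HasACDeriv (Icc 0 1) σ v)
    (h2 : IntervalIntegrable (fun t => ‖v t‖ ^ 2) volume 0 1) :
    (∫ z, u (σ 0 z : ℝ)) + (∫ t in (0 : ℝ)..1, -interactionEnergy W (σ t)) ≤
      α + ((∫ t in (0 : ℝ)..1, vlasovLagrangian V W c t (σ t) (v t)) + ∫ z, u (σ 1 z : ℝ)) := by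
  obtain ⟨f, hf⟩ := exists_isVersion (hσ.intervalIntegrable zero_le_one).1.aestronglyMeasurable
  have hf := hf 0 1 subset_rfl
  obtain ⟨hi, he⟩ := hf.integral_fiber_action hσ zero_le_one h2 hV c
  have h1 : ∫ z, u (σ 0 z : ℝ) ≤ ∫ z, (α + ((∫ t in (0 : ℝ)..1, particleLagrangian V c t
      (fiberPath (σ 0) f 0 z t : ℝ) (f (t, z))) + u (σ 1 z : ℝ))) := by
    refine integral_mono_ae (integrable_circle_comp hu _)
      ((integrable_const _).add (hi.add (integrable_circle_comp hu _))) ?_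
    filter_upwards [hf.fiberPath_hasACDeriv hσ zero_le_one, hf.fiberPath_sq zero_le_one h2,
      hf.fiberPath_ae_eq hσ zero_le_one (right_mem_Icc.2 zero_le_one)] with z e1 e2 e3
    -- Domination holds along almost every trajectory; integrating in z gives the mean action
    -- without interaction.
    have := hdom _ _ e1 e2
    rw [e3] at this
    simpa [fiberPath] using this
  have e := integral_add (integrable_const (μ := (volume : Measure Label)) α)
    (hi.add (integrable_circle_comp hu (σ 1)))
  have e' := integral_add hi (integrable_circle_comp hu (σ 1))
  simp only [Pi.add_apply] at e
  rw [e, e', he, integral_const, probReal_univ, one_smul] at h1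
  have hWi : IntervalIntegrable (fun t => interactionEnergy W (σ t)) volume 0 1 := by
    apply ContinuousOn.intervalIntegrable
    rw [uIcc_of_le zero_le_one]
    exact (continuous_interactionEnergy hW hK').comp_continuousOn (hσ.continuousOn zero_le_one)
  have hVW := (potentialEnergy_isTame hV hW hK hK').intervalIntegrable_tonelli_iff
    (meanForm c) hσ zero_le_one |>.2 h2
  have e3 : ∫ t in (0 : ℝ)..1, (1 / 2 * ‖v t‖ ^ 2 - externalEnergy V t (σ t) - ∫ z, c * v t z)
      = (∫ t in (0 : ℝ)..1, vlasovLagrangian V W c t (σ t) (v t))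
        + ∫ t in (0 : ℝ)..1, interactionEnergy W (σ t) := by
    simp only [vlasovLagrangian_eq_tonelli]
    rw [← intervalIntegral.integral_add hVW hWi]
    refine intervalIntegral.integral_congr fun t _ => ?_
    simp only [tonelli, potentialEnergy, meanForm_apply]
    ring
  rw [e3] at h1
  rw [intervalIntegral.integral_neg]
  linarith

end LiftedDomination

/-! ### A weak KAM solution in L²(I) by the Knaster–Tarski theorem -/

section VlasovKAM

open Topology

variable (V : UnitAddCircle × UnitAddCircle → ℝ) (W : UnitAddCircle → ℝ) (c α : ℝ)

/-- The Lax-Oleinik operator, shifted by `α`, on functions with extended real values. -/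
noncomputable def laxOleinikShift : (L2I → EReal) →o (L2I → EReal) where
  toFun f M := (⨅ (γ : ℝ → L2I) (w : ℝ → L2I) (_ : HasACDeriv (Icc 0 1) γ w ∧ γ 0 = M),
    extIntegral (fun t => vlasovLagrangian V W c t (γ t) (w t)) 0 1 + f (γ 1)) + (α : EReal)
  monotone' f g hfg M := by
    refine add_le_add (iInf_mono fun γ => iInf_mono fun w => iInf_mono fun h => ?_) le_rfl
    exact add_le_add le_rfl (hfg _)

variable {V W}

theorem potentialEnergy_congr {M N : L2I} (t : ℝ)
    (h : ∀ᵐ z, ((M z : ℝ) : UnitAddCircle) = (N z : ℝ)) :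
    potentialEnergy V W t M = potentialEnergy V W t N := by
  rw [potentialEnergy, potentialEnergy, externalEnergy_congr t h, interactionEnergy_congr h]

theorem vlasovLagrangian_add_L2Z (t : ℝ) (M N : L2I) {Z : L2I} (hZ : Z ∈ L2Z) :
    vlasovLagrangian V W c t (M + Z) N = vlasovLagrangian V W c t M N := by
  rw [vlasovLagrangian_eq_tonelli, vlasovLagrangian_eq_tonelli, tonelli, tonelli,
    potentialEnergy_congr t (coe_add_of_mem_L2Z M hZ)]

theorem vlasovLagrangian_comp (t : ℝ) (M N : L2I) (G : Label ≃ᵐ Label)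
    (hG : MeasurePreserving G volume volume) :
    vlasovLagrangian V W c t (Lp.compMeasurePreserving G hG M) (Lp.compMeasurePreserving G hG N)
      = vlasovLagrangian V W c t M N := by
  have hM := Lp.coeFn_compMeasurePreserving M hG
  have h1 : externalEnergy V t (Lp.compMeasurePreserving G hG M) = externalEnergy V t M := by
    rw [externalEnergy, externalEnergy,
      ← hG.integral_comp' (g := fun z => V ((t : UnitAddCircle), ((M z : ℝ) : UnitAddCircle)))]
    refine integral_congr_ae ?_
    filter_upwards [hM] with z hz
    rw [hz]; rfl
  have h2 : interactionEnergy W (Lp.compMeasurePreserving G hG M) = interactionEnergy W M := by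
    rw [interactionEnergy, interactionEnergy, ← hG.integral_comp'
      (g := fun z => ∫ z' : Label, W ((M z - M z' : ℝ) : UnitAddCircle))]
    congr 1
    refine integral_congr_ae ?_
    filter_upwards [hM] with z hz
    rw [← hG.integral_comp' (g := fun z' => W ((M (G z) - M z' : ℝ) : UnitAddCircle))]
    refine integral_congr_ae ?_
    filter_upwards [hM] with z' hz'
    rw [hz, hz']; rfl
  have h3 : ∫ z, c * (Lp.compMeasurePreserving G hG N) z = ∫ z, c * N z := by
    rw [← hG.integral_comp' (g := fun z => c * N z)]
    refine integral_congr_ae ?_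
    filter_upwards [Lp.coeFn_compMeasurePreserving N hG] with z hz
    rw [hz]; rfl
  rw [vlasovLagrangian, vlasovLagrangian, h1, h2, h3, Lp.norm_compMeasurePreserving]

theorem compMeasurePreserving_symm (M : L2I) (G : Label ≃ᵐ Label)
    (hG : MeasurePreserving G volume volume) (hG' : MeasurePreserving G.symm volume volume) :
    Lp.compMeasurePreserving G hG (Lp.compMeasurePreserving G.symm hG' M) = M := by
  refine Lp.ext ?_
  filter_upwards [Lp.coeFn_compMeasurePreserving (Lp.compMeasurePreserving G.symm hG' M) hG,
    hG.quasiMeasurePreserving.ae (Lp.coeFn_compMeasurePreserving M hG')] with z h1 h2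
  rw [h1, Function.comp_apply, h2]
  simp

variable {c α} {B K B' K' : ℝ}

theorem laxOleinikShift_le (hP : IsTame (potentialEnergy V W) B K) (f : L2I → EReal)
    {γ w : ℝ → L2I} (h : HasACDeriv (Icc 0 1) γ w)
    (h2 : IntervalIntegrable (fun t => ‖w t‖ ^ 2) volume 0 1) :
    laxOleinikShift V W c α f (γ 0) ≤
      ((∫ t in (0 : ℝ)..1, vlasovLagrangian V W c t (γ t) (w t) : ℝ) : EReal) + f (γ 1) + α := by
  have h3 := (hP.intervalIntegrable_tonelli_iff (meanForm c) h zero_le_one).2 h2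
  simp only [← vlasovLagrangian_eq_tonelli] at h3
  rw [← extIntegral_of_intervalIntegrable h3]
  exact add_le_add (iInf_le_of_le γ (iInf_le_of_le w (iInf_le_of_le ⟨h, rfl⟩ le_rfl))) le_rfl

theorem exists_of_laxOleinikShift_lt (hP : IsTame (potentialEnergy V W) B K) {f : L2I → EReal}
    (hf : ∀ M, f M ≠ ⊥) {M : L2I} {r : ℝ} (h : laxOleinikShift V W c α f M < r) :
    ∃ γ w : ℝ → L2I, HasACDeriv (Icc 0 1) γ w ∧ γ 0 = M ∧
      IntervalIntegrable (fun t => ‖w t‖ ^ 2) volume 0 1 ∧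
      ((∫ t in (0 : ℝ)..1, vlasovLagrangian V W c t (γ t) (w t) : ℝ) : EReal) + f (γ 1) + α
        < r := by
  have h1 : (⨅ (γ : ℝ → L2I) (w : ℝ → L2I) (_ : HasACDeriv (Icc 0 1) γ w ∧ γ 0 = M),
      extIntegral (fun t => vlasovLagrangian V W c t (γ t) (w t)) 0 1 + f (γ 1))
      < ((r - α : ℝ) : EReal) := by
    by_contra hcon
    have := add_le_add (not_lt.1 hcon) (le_refl (α : EReal))
    rw [← EReal.coe_add, sub_add_cancel] at this
    exact absurd h (not_lt.2 this)
  simp only [iInf_lt_iff] at h1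
  obtain ⟨γ, w, ⟨hγ, h0⟩, hlt⟩ := h1
  by_cases hi : IntervalIntegrable (fun t => vlasovLagrangian V W c t (γ t) (w t)) volume 0 1
  · rw [extIntegral_of_intervalIntegrable hi] at hlt
    simp only [vlasovLagrangian_eq_tonelli] at hi
    refine ⟨γ, w, hγ, h0, (hP.intervalIntegrable_tonelli_iff _ hγ zero_le_one).1 hi, ?_⟩
    have := EReal.add_lt_add_right_coe hlt α
    rwa [← EReal.coe_add, sub_add_cancel] at this
  · rw [extIntegral_of_not hi, EReal.top_add_of_ne_bot (hf _)] at hlt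
    exact absurd hlt not_top_lt

/-- Existence of an invariant fixed point of the Lax-Oleinik operator. -/
theorem exists_weakKAM (hV : IsTame (liftPotential V) B K) (hK : 0 ≤ K)
    (hW : IsTame (liftPotential fun p => W p.2) B' K') (hK' : 0 ≤ K')
    (hWn : ∀ x, W x ≤ 0) (hW0 : W 0 = 0) (c : ℝ) :
    ∃ (α : ℝ) (U : L2I → ℝ), IsGroupInvariant U ∧
      ∀ M : L2I, laxOleinik V W c U M + (α : EReal) = (U M : EReal) := by
  have hP := potentialEnergy_isTame hV hW hK hK'
  obtain ⟨α, u, hu, hdom, hcal⟩ := exists_particle_weakKAM hV hK (c • ContinuousLinearMap.id ℝ ℝ)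
  simp only [← particleLagrangian_eq_tonelli] at hdom hcal
  obtain ⟨Cu, hCu0, hCu⟩ := exists_abs_le_of_continuous hu
  have hint : ∀ M : L2I, 0 ≤ -interactionEnergy W M := by
    intro M
    have : (∫ z : Label, ∫ z' : Label, W ((M z - M z' : ℝ) : UnitAddCircle)) ≤ 0 :=
      integral_nonpos fun z => integral_nonpos fun z' => hWn _
    rw [interactionEnergy]; linarith
  -- Subsolution: particlewise domination survives averaging because -𝓦 ≥ 0.
  set m : L2I → EReal := fun M => ((∫ z, u (M z : ℝ) : ℝ) : EReal) with hm
  set Φ := laxOleinikShift V W c α with hΦ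
  have hmΦ : m ≤ Φ m := by
    intro M
    by_contra hcon
    obtain ⟨γ, w, h1, rfl, h2, h3⟩ := exists_of_laxOleinikShift_lt hP
      (fun M => EReal.coe_ne_bot _) (not_le.1 hcon)
    rw [← EReal.coe_add, ← EReal.coe_add, EReal.coe_lt_coe_iff] at h3
    have h4 := lift_domination hV hK hW hK' hu hdom h1 h2
    have h5 : 0 ≤ ∫ t in (0 : ℝ)..1, -interactionEnergy W (γ t) :=
      intervalIntegral.integral_nonneg zero_le_one fun t _ => hint _
    linarith
  -- Supersolution: an empty infimum gives +∞ off the constants modulo integers; on them, almost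
  -- optimal particle curves pay no interaction.
  set V₀ : L2I → EReal := fun M => ⨅ (x : ℝ) (_ : M - cst x ∈ L2Z), (u x : EReal) with hV₀
  have hΦV : Φ V₀ ≤ V₀ := by
    intro M
    refine le_iInf fun x => le_iInf fun hx => ?_
    by_contra hcon
    obtain ⟨r, hr1, hr2⟩ := EReal.lt_iff_exists_real_btwn.1 (not_le.1 hcon)
    rw [EReal.coe_lt_coe_iff] at hr1
    obtain ⟨γ, w, h1, h2, h3, h4⟩ := hcal x (r - u x) (by linarith)
    have hZ : M - cst (γ 0) ∈ L2Z := by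
      rw [sub_mem_L2Z_iff] at hx ⊢
      filter_upwards [hx, coeFn_cst x, coeFn_cst (γ 0)] with z e1 e2 e3
      rw [e1, e2, e3, h3]
    have hac := (h1.map zero_le_one cst).add_const (M - cst (γ 0))
    have h5 := laxOleinikShift_le (c := c) (α := α) hP V₀ hac (by simpa [norm_cst] using h2)
    simp only [add_sub_cancel, vlasovLagrangian_add_L2Z c _ _ _ hZ, vlasovLagrangian_eq_tonelli,
      tonelli_cst V hW0] at h5
    have h6 : V₀ (cst (γ 1) + (M - cst (γ 0))) ≤ (u (γ 1 : ℝ) : EReal) :=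
      iInf_le_of_le (γ 1) (iInf_le_of_le (by rw [add_sub_cancel_left]; exact hZ) le_rfl)
    have h7 := h5.trans (add_le_add (add_le_add le_rfl h6) le_rfl)
    rw [← EReal.coe_add, ← EReal.coe_add] at h7
    have h8 := hr2.trans_le h7
    rw [EReal.coe_lt_coe_iff] at h8
    linarith
  have hmV : m ≤ V₀ := by
    intro M
    refine le_iInf fun x => le_iInf fun hx => ?_
    rw [EReal.coe_le_coe_iff]
    have : ∫ z, u (M z : ℝ) = ∫ _ : Label, u x := by
      rw [sub_mem_L2Z_iff] at hx
      refine integral_congr_ae ?_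
      filter_upwards [hx, coeFn_cst x] with z e1 e2
      rw [e1, e2]
    rw [this]; simp
  -- Functions to `EReal` form a complete lattice. Joining with m keeps the least fixed point above
  -- m, and m ≤ Φ m makes it a fixed point of Φ itself.
  let Ψ : (L2I → EReal) →o (L2I → EReal) := ⟨fun f => m ⊔ Φ f, fun f g h =>
    sup_le_sup le_rfl (Φ.monotone h)⟩
  set U : L2I → EReal := Ψ.lfp with hU
  have hUfix : m ⊔ Φ U = U := Ψ.map_lfp
  have hmU : m ≤ U := le_sup_left.trans_eq hUfix
  have hΦU : Φ U = U := by
    refine le_antisymm (le_sup_right.trans_eq hUfix) ?_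
    nth_rewrite 1 [← hUfix]
    exact sup_le (hmΦ.trans (Φ.monotone hmU)) le_rfl
  have hUle : ∀ f, m ≤ f → Φ f ≤ f → U ≤ f := fun f h1 h2 => Ψ.lfp_le (sup_le h1 h2)
  have hUV : U ≤ V₀ := hUle _ hmV hΦV
  -- Cost of a straight segment of length at most 1 to an integer-valued function, where V₀ ≤ u 0.
  set R : ℝ := 1 / 2 + (B + B') + ‖meanForm c‖ + u 0 + α with hR
  have hUR : ∀ M, U M ≤ (R : EReal) := by
    intro M
    obtain ⟨Z, hZ, hMZ⟩ := exists_L2Z_near M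
    have hac := hasACDeriv_affine zero_le_one M (Z - M)
    have h5 := laxOleinikShift_le (c := c) (α := α) hP V₀ hac intervalIntegrable_const
    have h6 := hP.integral_affine_le (meanForm c) 0 M (Z - M)
    simp only [zero_add, ← vlasovLagrangian_eq_tonelli] at h6
    simp only [sub_zero, zero_smul, add_zero, one_smul, add_sub_cancel] at h5 h6
    have h7 : V₀ Z ≤ (u 0 : EReal) := by
      refine iInf_le_of_le 0 (iInf_le_of_le ?_ ?_)
      · rw [map_zero, sub_zero]; exact hZ
      · rw [AddCircle.coe_zero]
    have h8 : U M ≤ Φ V₀ M := by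
      rw [← hΦU]; exact Φ.monotone hUV M
    refine (h8.trans (h5.trans (add_le_add (add_le_add le_rfl h7) le_rfl))).trans ?_
    rw [← EReal.coe_add, ← EReal.coe_add, EReal.coe_le_coe_iff]
    rw [norm_sub_rev] at hMZ
    have h9 : ‖Z - M‖ ^ 2 ≤ 1 := by nlinarith [norm_nonneg (Z - M)]
    have h10 : ‖meanForm c‖ * ‖Z - M‖ ≤ ‖meanForm c‖ :=
      mul_le_of_le_one_right (norm_nonneg _) hMZ
    linarith
  have hUtop : ∀ M, U M ≠ ⊤ := fun M => ((hUR M).trans_lt (EReal.coe_lt_top _)).ne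
  have hUbot : ∀ M, U M ≠ ⊥ := fun M => ((EReal.bot_lt_coe _).trans_le (hmU M)).ne'
  have hcoe : ∀ M, ((U M).toReal : EReal) = U M := fun M => EReal.coe_toReal (hUtop M) (hUbot M)
  have hUlow : ∀ M, -Cu ≤ (U M).toReal := by
    intro M
    have h1 := hmU M
    rw [← hcoe, EReal.coe_le_coe_iff] at h1
    exact (abs_le.1 (abs_integral_circle_comp_le hu hCu M)).1.trans h1
  have hUup : ∀ M, (U M).toReal ≤ R := by
    intro M
    have h1 := hUR M
    rwa [← hcoe, EReal.coe_le_coe_iff] at h1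
  -- Invariance follows from leastness: for a symmetry g of m and of the Lagrangian, U ∘ g is again
  -- a prefixed point above m. Using g and its inverse gives equality.
  have hinv : ∀ g g' : L2I → L2I, (∀ M, g (g' M) = M) → (∀ M, g' (g M) = M) →
      (∀ M, ∫ z, u (g M z : ℝ) = ∫ z, u (M z : ℝ)) →
      (∀ γ w : ℝ → L2I, HasACDeriv (Icc 0 1) γ w → ∃ w' : ℝ → L2I,
        HasACDeriv (Icc 0 1) (fun t => g' (γ t)) w' ∧ ∀ t,
          vlasovLagrangian V W c t (g' (γ t)) (w' t) = vlasovLagrangian V W c t (γ t) (w t)) →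
      ∀ M, U M ≤ U (g M) := by
    intro g g' h1 h2 h3 h4
    refine hUle (fun M => U (g M)) (fun M => ?_) (fun M => ?_)
    · refine le_of_eq_of_le ?_ (hmU (g M))
      simp only [hm, h3]
    · refine le_of_le_of_eq ?_ (congrFun hΦU (g M))
      refine add_le_add (le_iInf fun γ => le_iInf fun w => le_iInf fun h => ?_) le_rfl
      obtain ⟨w', e1, e2⟩ := h4 γ w h.1
      refine iInf_le_of_le (fun t => g' (γ t)) (iInf_le_of_le w' (iInf_le_of_le
        ⟨e1, (congrArg g' h.2).trans (h2 M)⟩ ?_))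
      simp only [e2, h1, le_refl]
  refine ⟨α, fun M => (U M).toReal, ⟨?_, ?_, ?_⟩, ?_⟩
  -- A curve from M that is optimal up to 1 has action at most U M + 1 - α - U (γ 1), and -Cu ≤ U ≤
  -- R. Moving its origin makes U locally Lipschitz.
  · obtain ⟨C, hC0, hC⟩ := hP.exists_move_start (add_nonneg hK hK') (meanForm c) (R + 1 + Cu - α)
    have key : ∀ M h : L2I, ‖h‖ ≤ 1 → (U (M + h)).toReal ≤ (U M).toReal + C * ‖h‖ := by
      intro M h hh
      refine le_of_forall_pos_lt_add fun ε hε => ?_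
      have hlt : Φ U M < (((U M).toReal + min ε 1 : ℝ) : EReal) := by
        rw [hΦU, ← hcoe, EReal.coe_lt_coe_iff]
        simp only [EReal.toReal_coe]
        linarith [lt_min hε one_pos]
      obtain ⟨γ, w, h1, rfl, h2, h3⟩ := exists_of_laxOleinikShift_lt hP hUbot hlt
      rw [← hcoe (γ 1), ← EReal.coe_add, ← EReal.coe_add, EReal.coe_lt_coe_iff] at h3
      simp only [vlasovLagrangian_eq_tonelli] at h3
      obtain ⟨γ', w', e1, e2, e3, e4, e5⟩ := hC γ w h1 h2
        (by linarith [hUlow (γ 1), hUup (γ 0), min_le_right ε 1]) h hh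
      have h5 := laxOleinikShift_le (c := c) (α := α) hP U e1 e2
      rw [← hΦ, hΦU, e3, e4, ← hcoe (γ 1), ← hcoe (γ 0 + h), ← EReal.coe_add, ← EReal.coe_add,
        EReal.coe_le_coe_iff] at h5
      simp only [vlasovLagrangian_eq_tonelli] at h5
      linarith [min_le_left ε 1]
    rw [Metric.continuous_iff]
    intro M ε hε
    refine ⟨min 1 (ε / (C + 1)), by positivity, fun N hN => ?_⟩
    rw [dist_eq_norm] at hN
    have h1 := key M (N - M) (hN.le.trans (min_le_left _ _))
    have h2 := key N (M - N) (by rw [norm_sub_rev]; exact hN.le.trans (min_le_left _ _))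
    rw [add_sub_cancel] at h1 h2
    rw [norm_sub_rev] at h2
    have h3 : C * ‖N - M‖ < ε := by
      have h4 : ‖N - M‖ < ε / (C + 1) := hN.trans_le (min_le_right _ _)
      rw [lt_div_iff₀ (by linarith)] at h4
      nlinarith [norm_nonneg (N - M)]
    rw [Real.dist_eq, abs_lt]
    constructor <;> linarith
  · intro M Z hZ
    have hmean : ∀ Z' ∈ L2Z, ∀ M : L2I, ∫ z, u ((M + Z') z : ℝ) = ∫ z, u (M z : ℝ) := by
      intro Z' hZ' M
      refine integral_congr_ae ?_
      filter_upwards [coe_add_of_mem_L2Z M hZ'] with z hz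
      rw [hz]
    have hstep : ∀ Z' ∈ L2Z, ∀ M, U M ≤ U (M + Z') := by
      intro Z' hZ'
      refine hinv (fun M => M + Z') (fun M => M + -Z') (by simp) (by simp) (hmean Z' hZ') ?_
      intro γ w h
      exact ⟨w, h.add_const _, fun t => vlasovLagrangian_add_L2Z c _ _ _ (neg_mem_L2Z hZ')⟩
    have h1 := hstep (-Z) (neg_mem_L2Z hZ) (M + Z)
    rw [add_neg_cancel_right] at h1
    simp only [le_antisymm h1 (hstep Z hZ M)]
  · intro G hG M
    have hG' : MeasurePreserving G.symm volume volume := hG.symm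
    have hmean : ∀ (G : Label ≃ᵐ Label) (hG : MeasurePreserving G volume volume) (M : L2I),
        ∫ z, u ((Lp.compMeasurePreserving G hG M) z : ℝ) = ∫ z, u (M z : ℝ) := by
      intro G hG M
      rw [← hG.integral_comp' (g := fun z => u (M z : ℝ))]
      refine integral_congr_ae ?_
      filter_upwards [Lp.coeFn_compMeasurePreserving M hG] with z hz
      rw [hz]; rfl
    have hac : ∀ (G : Label ≃ᵐ Label) (hG : MeasurePreserving G volume volume) (γ w : ℝ → L2I),
        HasACDeriv (Icc 0 1) γ w → ∃ w' : ℝ → L2I,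
          HasACDeriv (Icc 0 1) (fun t => Lp.compMeasurePreserving G hG (γ t)) w' ∧ ∀ t,
          vlasovLagrangian V W c t (Lp.compMeasurePreserving G hG (γ t)) (w' t)
            = vlasovLagrangian V W c t (γ t) (w t) := by
      intro G hG γ w h
      exact ⟨_, h.map zero_le_one (Lp.compMeasurePreservingₗᵢ ℝ G hG).toContinuousLinearMap,
        fun t => vlasovLagrangian_comp c t _ _ G hG⟩
    have hs := compMeasurePreserving_symm (hG := hG) (hG' := hG') (G := G)
    have hs' : ∀ M, Lp.compMeasurePreserving G.symm hG' (Lp.compMeasurePreserving G hG M) = M :=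
      fun M => compMeasurePreserving_symm M G.symm hG' hG
    have h1 := hinv _ _ hs hs' (hmean G hG) (hac G.symm hG')
    have h2 := hinv _ _ hs' hs (hmean G.symm hG') (hac G hG)
    have h3 := h2 (Lp.compMeasurePreserving G hG M)
    rw [hs'] at h3
    simp only [le_antisymm h3 (h1 M)]
  · intro M
    rw [hcoe, ← congrFun hΦU M]
    simp only [laxOleinik, hcoe]
    rfl

end VlasovKAM

/-! ### A priori bounds for minimal curves -/

section Minimal

open Topology

variable {V : UnitAddCircle × UnitAddCircle → ℝ} {W : UnitAddCircle → ℝ} {c B K : ℝ}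
  {σ v : ℝ → L2I}

/-- The straight segment has finite action, so the minimal action is not +∞. -/
theorem IsVlasovMinimal.intervalIntegrable_sq (hP : IsTame (potentialEnergy V W) B K)
    (hσ : IsVlasovMinimal V W c univ σ v) {a b : ℝ} (hab : a < b) :
    IntervalIntegrable (fun t => ‖v t‖ ^ 2) volume a b := by
  have hac := hasACDeriv_affine hab.le (σ a) ((b - a)⁻¹ • (σ b - σ a))
  have hi := (hP.intervalIntegrable_tonelli_iff (meanForm c) hac hab.le).2 intervalIntegrable_const
  simp only [← vlasovLagrangian_eq_tonelli] at hi
  have h := hσ.2 a b hab (subset_univ _) _ _ hac (by simpa using zero_mem_L2Z) (by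
    rw [smul_inv_smul₀ (sub_ne_zero.2 hab.ne')]
    simpa using zero_mem_L2Z)
  rw [extIntegral_of_intervalIntegrable hi] at h
  have h1 : IntervalIntegrable (fun t => vlasovLagrangian V W c t (σ t) (v t)) volume a b := by
    by_contra hn
    rw [extIntegral_of_not hn] at h
    exact EReal.coe_ne_top _ (top_le_iff.1 h)
  simp only [vlasovLagrangian_eq_tonelli] at h1
  exact (hP.intervalIntegrable_tonelli_iff _ (hσ.1.mono (subset_univ _)) hab.le).1 h1

theorem IsVlasovMinimal.intervalIntegrable (hP : IsTame (potentialEnergy V W) B K)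
    (hσ : IsVlasovMinimal V W c univ σ v) {a b : ℝ} (hab : a < b) :
    IntervalIntegrable (fun t => vlasovLagrangian V W c t (σ t) (v t)) volume a b := by
  simp only [vlasovLagrangian_eq_tonelli]
  exact (hP.intervalIntegrable_tonelli_iff _ (hσ.1.mono (subset_univ _)) hab.le).2
    (hσ.intervalIntegrable_sq hP hab)

theorem IsVlasovMinimal.integral_le (hP : IsTame (potentialEnergy V W) B K)
    (hσ : IsVlasovMinimal V W c univ σ v) {a b : ℝ} (hab : a < b) {τ w : ℝ → L2I}
    (hτ : HasACDeriv (Icc a b) τ w) (h2 : IntervalIntegrable (fun t => ‖w t‖ ^ 2) volume a b)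
    (ha : τ a - σ a ∈ L2Z) (hb : τ b - σ b ∈ L2Z) :
    ∫ t in a..b, vlasovLagrangian V W c t (σ t) (v t) ≤
      ∫ t in a..b, vlasovLagrangian V W c t (τ t) (w t) := by
  have h := hσ.2 a b hab (subset_univ _) τ w hτ ha hb
  have hi := (hP.intervalIntegrable_tonelli_iff (meanForm c) hτ hab.le).2 h2
  simp only [← vlasovLagrangian_eq_tonelli] at hi
  rwa [extIntegral_of_intervalIntegrable (hσ.intervalIntegrable hP hab),
    extIntegral_of_intervalIntegrable hi, EReal.coe_le_coe_iff] at h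

/-- The displacement of a minimal curve in unit time is bounded. -/
theorem IsVlasovMinimal.exists_displacement_bound (hP : IsTame (potentialEnergy V W) B K)
    (hσ : IsVlasovMinimal V W c univ σ v) :
    ∃ D, 0 ≤ D ∧ ∀ a, ‖σ (a + 1) - σ a‖ ≤ D := by
  set ℓ := meanForm c
  refine ⟨2 * (1 / 2 + B + ‖ℓ‖ + (B + ‖ℓ‖ ^ 2)) + 1 / 2, ?_, fun a => ?_⟩
  · have : 0 ≤ B := (abs_nonneg _).trans (hP.bound 0 0)
    positivity
  have hab : a < a + 1 := by linarith
  -- Endpoints matter only modulo integers, so a competitor with displacement at most 1 bounds the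
  -- action, hence the displacement of σ, uniformly in a.
  obtain ⟨Z, hZ, hn⟩ := exists_L2Z_near (σ (a + 1) - σ a)
  set y := σ (a + 1) - σ a - Z with hy
  have hac := hasACDeriv_affine hab.le (σ a) y
  have h1 := hσ.integral_le hP hab hac intervalIntegrable_const
    (by simpa using zero_mem_L2Z) (by
      have : σ a + (a + 1 - a) • y - σ (a + 1) = -Z := by
        rw [add_sub_cancel_left, one_smul, hy]; abel
      rw [this]; exact neg_mem_L2Z hZ)
  simp only [vlasovLagrangian_eq_tonelli] at h1
  have h2 := hP.integral_affine_le ℓ a (σ a) y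
  have hs := hσ.intervalIntegrable_sq hP hab
  have hσac := hσ.1.mono (subset_univ (Icc a (a + 1)))
  have h3 := hP.integral_sq_le ℓ hσac hab.le hs
  have h4 := hσac.norm_sub_le hab.le hs le_rfl hab.le le_rfl
  have h5 : ‖y‖ ^ 2 ≤ 1 := by nlinarith [norm_nonneg y]
  have h6 : ‖ℓ‖ * ‖y‖ ≤ ‖ℓ‖ := mul_le_of_le_one_right (norm_nonneg _) hn
  linarith

end Minimal

/-! ### Finiteness of the total interaction cost -/

section CriticalValue

open Topology

variable {V : UnitAddCircle × UnitAddCircle → ℝ} {W : UnitAddCircle → ℝ} {B K B' K' : ℝ}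

theorem continuous_of_comp_coe {Y : Type*} [TopologicalSpace Y] {f : UnitAddCircle → Y}
    (h : Continuous fun x : ℝ => f x) : Continuous f :=
  (QuotientAddGroup.isQuotientMap_mk (N := AddSubgroup.zmultiples (1 : ℝ))).continuous_iff.2 h

theorem interactionEnergy_nonpos (hWn : ∀ x, W x ≤ 0) (M : L2I) : interactionEnergy W M ≤ 0 := by
  have : (∫ z : Label, ∫ z' : Label, W ((M z - M z' : ℝ) : UnitAddCircle)) ≤ 0 :=
    integral_nonpos fun z => integral_nonpos fun z' => hWn _
  rw [interactionEnergy]; linarith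

/-- There is a function on the circle dominated by the particle Lagrangian at the critical value
of the Vlasov Lagrangian. -/
theorem exists_dominated_criticalValue (hV : IsTame (liftPotential V) B K) (hK : 0 ≤ K)
    (hW : IsTame (liftPotential fun p => W p.2) B' K') (hK' : 0 ≤ K')
    (hWn : ∀ x, W x ≤ 0) (hW0 : W 0 = 0) (c : ℝ) :
    ∃ u : UnitAddCircle → ℝ, Continuous u ∧ ∀ γ w : ℝ → ℝ, HasACDeriv (Icc 0 1) γ w →
      IntervalIntegrable (fun t => ‖w t‖ ^ 2) volume 0 1 →
      u (γ 0 : ℝ) ≤ criticalValue V W c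
        + ((∫ t in (0 : ℝ)..1, particleLagrangian V c t (γ t : ℝ) (w t)) + u (γ 1 : ℝ)) := by
  have hP := potentialEnergy_isTame hV hW hK hK'
  obtain ⟨U, hU, hfix⟩ : ∃ U : L2I → ℝ, IsGroupInvariant U ∧
      ∀ M : L2I, laxOleinik V W c U M + (criticalValue V W c : EReal) = (U M : EReal) :=
    -- Existence of some fixed point guarantees that the chosen `criticalValue` has one; the level
    -- found by that construction need not be identified with it.
    Classical.epsilon_spec (exists_weakKAM hV hK hW hK' hWn hW0 c)
  obtain ⟨s, hs⟩ := (QuotientAddGroup.mk_surjective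
    (s := AddSubgroup.zmultiples (1 : ℝ))).hasRightInverse
  have hs : ∀ x : UnitAddCircle, ((s x : ℝ) : UnitAddCircle) = x := hs
  have hu : ∀ x : ℝ, U (cst (s x)) = U (cst x) := by
    intro x
    have h1 : cst (s x) - cst x ∈ L2Z := by
      rw [sub_mem_L2Z_iff]
      filter_upwards [coeFn_cst (s x), coeFn_cst x] with z e1 e2
      rw [e1, e2, hs]
    have := hU.add_mem_L2Z (cst x) _ h1
    rwa [add_sub_cancel] at this
  refine ⟨fun x => U (cst (s x)), ?_, fun γ w h1 h2 => ?_⟩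
  · refine continuous_of_comp_coe ?_
    simp only [hu]
    exact hU.continuous.comp cst.continuous
  · simp only [hu]
    have hac := h1.map zero_le_one cst
    have h5 := laxOleinikShift_le (c := c) (α := criticalValue V W c) hP
      (fun M => (U M : EReal)) hac (by simpa [norm_cst] using h2)
    have h6 := (hfix (cst (γ 0))).symm.trans_le h5
    simp only [vlasovLagrangian_eq_tonelli, tonelli_cst V hW0] at h6
    rw [← EReal.coe_add, ← EReal.coe_add, EReal.coe_le_coe_iff] at h6
    linarith

theorem vlasovLagrangian_add_intCast (c t : ℝ) (n : ℤ) (M N : L2I) :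
    vlasovLagrangian V W c (t + n) M N = vlasovLagrangian V W c t M N := by
  simp only [vlasovLagrangian, externalEnergy, coe_add_intCast]

variable {c : ℝ} {σ v : ℝ → L2I}

/-- Along a minimal curve, the interaction energy is controlled by the action. -/
theorem IsVlasovMinimal.integral_interaction_le (hV : IsTame (liftPotential V) B K) (hK : 0 ≤ K)
    (hW : IsTame (liftPotential fun p => W p.2) B' K') (hK' : 0 ≤ K')
    (hσ : IsVlasovMinimal V W c univ σ v) {α : ℝ} {u : UnitAddCircle → ℝ} (hu : Continuous u)
    (hdom : ∀ γ w : ℝ → ℝ, HasACDeriv (Icc 0 1) γ w →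
      IntervalIntegrable (fun t => ‖w t‖ ^ 2) volume 0 1 →
      u (γ 0 : ℝ) ≤ α + ((∫ t in (0 : ℝ)..1, particleLagrangian V c t (γ t : ℝ) (w t))
        + u (γ 1 : ℝ))) (a : ℤ) (n : ℕ) :
    (∫ z, u (σ a z : ℝ)) + (∫ t in (a : ℝ)..(a + n), -interactionEnergy W (σ t)) ≤
      (∫ t in (a : ℝ)..(a + n), (vlasovLagrangian V W c t (σ t) (v t) + α))
        + ∫ z, u (σ (a + n) z : ℝ) := by
  have hP := potentialEnergy_isTame hV hW hK hK'
  have hcont : Continuous fun t => -interactionEnergy W (σ t) :=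
    ((continuous_interactionEnergy hW hK').comp hσ.1.continuous).neg
  have hint : ∀ a b : ℝ, IntervalIntegrable
      (fun t => vlasovLagrangian V W c t (σ t) (v t) + α) volume a b := by
    intro a b
    rcases lt_trichotomy a b with h | h | h
    · exact (hσ.intervalIntegrable hP h).add intervalIntegrable_const
    · subst h; exact IntervalIntegrable.refl
    · exact ((hσ.intervalIntegrable hP h).add intervalIntegrable_const).symm
  induction n with
  | zero => simp
  | succ n ih =>
    set j : ℤ := a + n with hj
    have hjr : (a : ℝ) + n = j := by rw [hj]; push_cast; ring
    have hj1 : (a : ℝ) + (n + 1 : ℕ) = j + 1 := by rw [hj]; push_cast; ring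
    rw [hjr] at ih
    rw [hj1]
    have h1 := (hσ.1.mono (subset_univ (Icc (j : ℝ) (j + 1)))).comp_add_right (by linarith) (j : ℝ)
    have h2 := (hσ.intervalIntegrable_sq hP (by linarith : (j : ℝ) < j + 1)).comp_add_right (j : ℝ)
    rw [sub_self, add_sub_cancel_left] at h1 h2
    -- Domination is known on [0, 1] only; an integer shift preserves the Lagrangian because V is
    -- 1-periodic in time.
    have h3 := lift_domination hV hK hW hK' hu hdom h1 h2
    have e1 : ∫ t in (0 : ℝ)..1, vlasovLagrangian V W c t (σ (t + j)) (v (t + j))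
        = (∫ t in (j : ℝ)..(j + 1), (vlasovLagrangian V W c t (σ t) (v t) + α)) - α := by
      rw [intervalIntegral.integral_add (hσ.intervalIntegrable hP (by linarith))
        intervalIntegrable_const]
      have := intervalIntegral.integral_comp_add_right (a := 0) (b := 1)
        (fun t => vlasovLagrangian V W c t (σ t) (v t)) (j : ℝ)
      simp only [vlasovLagrangian_add_intCast] at this
      rw [this]
      simp [add_comm]
    have e2 := intervalIntegral.integral_comp_add_right (a := 0) (b := 1)
      (fun t => -interactionEnergy W (σ t)) (j : ℝ)
    simp only [zero_add] at h3 e2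
    rw [e1, e2, add_comm (1 : ℝ)] at h3
    rw [← intervalIntegral.integral_add_adjacent_intervals (hcont.intervalIntegrable a j)
      (hcont.intervalIntegrable j (j + 1)), ← intervalIntegral.integral_add_adjacent_intervals
      (hint a j) (hint j (j + 1))]
    linarith

theorem IsVlasovMinimal.exists_interaction_bound (hV : IsTame (liftPotential V) B K) (hK : 0 ≤ K)
    (hW : IsTame (liftPotential fun p => W p.2) B' K') (hK' : 0 ≤ K')
    (hWn : ∀ x, W x ≤ 0) (hW0 : W 0 = 0) (hσ : IsVlasovMinimal V W c univ σ v)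
    (hlim : liminf (fun k : ℕ => extIntegral (fun t => vlasovLagrangian V W c t (σ t) (v t)
        + criticalValue V W c) (-(k : ℝ)) (k : ℝ)) atTop < ⊤) :
    ∃ R, ∀ k : ℕ, ∫ t in (-(k : ℝ))..k, -interactionEnergy W (σ t) ≤ R := by
  have hP := potentialEnergy_isTame hV hW hK hK'
  obtain ⟨u, hu, hdom⟩ := exists_dominated_criticalValue hV hK hW hK' hWn hW0 c
  obtain ⟨C, hC0, hC⟩ := exists_abs_le_of_continuous hu
  obtain ⟨r, hr, -⟩ := EReal.lt_iff_exists_real_btwn.1 hlim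
  have hfreq := frequently_lt_of_liminf_lt (by isBoundedDefault) hr
  have hcont : Continuous fun t => -interactionEnergy W (σ t) :=
    ((continuous_interactionEnergy hW hK').comp hσ.1.continuous).neg
  refine ⟨r + 2 * C, fun k => ?_⟩
  -- The action is bounded only along a subsequence, but the cost is nonnegative, so [-k, k] is
  -- controlled by a larger [-m, m]; the shift by 1 makes m > 0.
  obtain ⟨m, hm, hkm⟩ := (hfreq.and_eventually (eventually_ge_atTop (k + 1))).exists
  have hmpos : (0 : ℝ) < m := by exact_mod_cast (by omega : 0 < m)
  have hkm' : (k : ℝ) ≤ m := by exact_mod_cast (by omega : k ≤ m)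
  have hi : IntervalIntegrable (fun t => vlasovLagrangian V W c t (σ t) (v t)
      + criticalValue V W c) volume (-(m : ℝ)) m :=
    (hσ.intervalIntegrable hP (by linarith)).add intervalIntegrable_const
  rw [extIntegral_of_intervalIntegrable hi, EReal.coe_lt_coe_iff] at hm
  have h1 := hσ.integral_interaction_le hV hK hW hK' hu hdom (-(m : ℤ)) (2 * m)
  have e1 : ((-(m : ℤ) : ℤ) : ℝ) = -(m : ℝ) := by push_cast; ring
  have e2 : -(m : ℝ) + ((2 * m : ℕ) : ℝ) = m := by push_cast; ring
  rw [e1, e2] at h1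
  have h2 := (abs_le.1 (abs_integral_circle_comp_le hu hC (σ (-(m : ℝ))))).1
  have h3 := (abs_le.1 (abs_integral_circle_comp_le hu hC (σ (m : ℝ)))).2
  have h4 : ∫ t in (-(k : ℝ))..k, -interactionEnergy W (σ t) ≤
      ∫ t in (-(m : ℝ))..m, -interactionEnergy W (σ t) :=
    intervalIntegral.integral_mono_interval (by linarith) (by linarith [(k.cast_nonneg : (0:ℝ) ≤ k)])
      hkm' (ae_of_all _ fun t => neg_nonneg.2 (interactionEnergy_nonpos hWn _))
      (hcont.intervalIntegrable _ _)
  linarith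

end CriticalValue

/-! ### Small interaction cost forces concentration -/

section Concentration

open Topology

theorem exists_small_of_integral_bounded {g : ℝ → ℝ} (hg : Continuous g) (h0 : ∀ t, 0 ≤ g t)
    {R : ℝ} (hR : ∀ k : ℕ, ∫ t in (-(k : ℝ))..k, g t ≤ R) {δ : ℝ} (hδ : 0 < δ) (T : ℝ) :
    ∃ b, T ≤ b ∧ g b < δ := by
  by_contra! hcon
  set S := max T 0 with hS
  obtain ⟨k, hk⟩ := exists_nat_gt (S + (|R| + 1) / δ)
  have hpos : 0 < (|R| + 1) / δ := by positivity
  have hS0 : 0 ≤ S := le_max_right _ _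
  have hSk : S ≤ k := by linarith
  have h1 : ∫ t in S..k, δ ≤ ∫ t in S..k, g t :=
    intervalIntegral.integral_mono_on hSk intervalIntegrable_const (hg.intervalIntegrable _ _)
      fun t ht => hcon t ((le_max_left _ _).trans ht.1)
  have h2 : ∫ t in S..k, g t ≤ ∫ t in (-(k : ℝ))..k, g t :=
    intervalIntegral.integral_mono_interval (by linarith [(k.cast_nonneg : (0:ℝ) ≤ k)]) hSk le_rfl
      (ae_of_all _ h0) (hg.intervalIntegrable _ _)
  rw [intervalIntegral.integral_const, smul_eq_mul] at h1
  have h3 : |R| + 1 < (k - S) * δ := by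
    rw [← div_lt_iff₀ hδ]; linarith
  linarith [hR k, le_abs_self R]

variable {W : UnitAddCircle → ℝ} {B K : ℝ}

/-- A configuration with small interaction energy is close to a Dirac mass. -/
theorem exists_near_const_of_interaction_small (hW : IsTame (liftPotential fun p => W p.2) B K)
    (hWn : ∀ x, W x ≤ 0) (hWz : ∀ x, W x = 0 ↔ x = 0) {η : ℝ} (hη : 0 < η) :
    ∃ δ > 0, ∀ M : L2I, -interactionEnergy W M < δ →
      ∃ (x : ℝ) (Z r : L2I), Z ∈ L2Z ∧ M = cst x + Z + r ∧ ‖r‖ ≤ η := by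
  have hWc : Continuous W := continuous_of_comp_coe
    (hW.cont.comp (continuous_const (y := (0 : ℝ)).prodMk continuous_id))
  have hnorm : ∀ x : UnitAddCircle, ‖x‖ ≤ 1 := by
    intro x
    have := AddCircle.norm_le_half_period (1 : ℝ) one_ne_zero (x := x)
    rw [abs_one] at this
    linarith
  -- Compactness: away from 0, -W has a positive minimum, while near 0 the term η² / 2 suffices. No
  -- rate of vanishing of W is involved.
  obtain ⟨C, hC0, hC⟩ : ∃ C, 0 ≤ C ∧ ∀ s : UnitAddCircle, ‖s‖ ^ 2 ≤ η ^ 2 / 2 + C * (-W s) := by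
    set S : Set UnitAddCircle := {s | η ^ 2 / 2 ≤ ‖s‖ ^ 2} with hS
    have hSc : IsCompact S := (isClosed_le continuous_const (continuous_norm.pow 2)).isCompact
    rcases S.eq_empty_or_nonempty with he | hne
    · refine ⟨0, le_rfl, fun s => ?_⟩
      have : s ∉ S := by rw [he]; exact notMem_empty s
      simp only [hS, mem_ofPred_eq, not_le] at this
      linarith
    · obtain ⟨s₀, hs₀, hmin⟩ := hSc.exists_isMinOn hne hWc.neg.continuousOn
      have hpos : 0 < -W s₀ := by
        refine lt_of_le_of_ne (neg_nonneg.2 (hWn _)) fun h => ?_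
        have h1 : s₀ = 0 := (hWz s₀).1 (by linarith)
        simp only [hS, mem_ofPred_eq, h1, norm_zero] at hs₀
        nlinarith [sq_pos_of_pos hη]
      refine ⟨1 / -W s₀, by positivity, fun s => ?_⟩
      have hWs : 0 ≤ -W s := neg_nonneg.2 (hWn s)
      by_cases hs : s ∈ S
      · have h1 : -W s₀ ≤ -W s := hmin hs
        have h2 : 1 ≤ 1 / -W s₀ * (-W s) := by
          rw [one_div, inv_mul_eq_div, one_le_div hpos]; exact h1
        nlinarith [hnorm s, norm_nonneg s, sq_nonneg η]
      · simp only [hS, mem_ofPred_eq, not_le] at hs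
        have : 0 ≤ 1 / -W s₀ * (-W s) := by positivity
        linarith
  refine ⟨η ^ 2 / (4 * (C + 1)), by positivity, fun M hM => ?_⟩
  have hWi := integrable_interaction hW M
  have hWi' : Integrable (fun p : Label × Label => -W ((M p.1 - M p.2 : ℝ) : UnitAddCircle))
      (volume.prod volume) := hWi.neg
  have hMm := (Lp.stronglyMeasurable M).measurable
  have hNi : Integrable (fun p : Label × Label => ‖((M p.1 - M p.2 : ℝ) : UnitAddCircle)‖ ^ 2)
      (volume.prod volume) := by
    refine Integrable.of_bound ?_ 1 (ae_of_all _ fun p => ?_)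
    · exact (((continuous_norm.comp (AddCircle.continuous_mk' 1)).pow 2).measurable.comp
        ((hMm.comp measurable_fst).sub (hMm.comp measurable_snd))).aestronglyMeasurable
    · rw [Real.norm_of_nonneg (by positivity)]
      nlinarith [hnorm ((M p.1 - M p.2 : ℝ) : UnitAddCircle),
        norm_nonneg ((M p.1 - M p.2 : ℝ) : UnitAddCircle)]
  have h1 : ∫ p : Label × Label, ‖((M p.1 - M p.2 : ℝ) : UnitAddCircle)‖ ^ 2 ∂(volume.prod volume)
      ≤ η ^ 2 := by
    calc _ ≤ ∫ p : Label × Label, (η ^ 2 / 2 + C * (-W ((M p.1 - M p.2 : ℝ) : UnitAddCircle)))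
          ∂(volume.prod volume) :=
          integral_mono hNi ((integrable_const _).add (hWi'.const_mul C)) fun p => hC _
      _ = η ^ 2 / 2 + 2 * C * (-interactionEnergy W M) := by
          rw [integral_add (integrable_const _) (hWi'.const_mul C), integral_const_mul,
            interactionEnergy_eq_integral_prod hW, integral_const, probReal_univ, one_smul]
          rw [integral_neg]
          ring
      _ ≤ _ := by
          rw [lt_div_iff₀ (by positivity)] at hM
          have := interactionEnergy_nonpos hWn M
          nlinarith
  rw [integral_prod _ hNi] at h1
  -- Some particle z₀ has at most the average squared distance to the others; its position is the
  -- constant, and rounding supplies Z.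
  obtain ⟨z₀, hz₀⟩ := exists_le_integral hNi.integral_prod_left
  have h2 := hz₀.trans h1
  obtain ⟨Z, hZ, hr⟩ := exists_L2Z_round (M - cst (M z₀))
  refine ⟨M z₀, Z, M - cst (M z₀) - Z, hZ, by abel, ?_⟩
  refine le_of_sq_le_sq ?_ hη.le
  rw [← L2I.integral_sq]
  refine le_of_eq_of_le ?_ h2
  refine integral_congr_ae ?_
  filter_upwards [hr, Lp.coeFn_sub M (cst (M z₀)), coeFn_cst (M z₀)] with z e1 e2 e3
  rw [e1, e2, Pi.sub_apply, e3, ← neg_sub (M z), AddCircle.coe_neg, norm_neg,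
    UnitAddCircle.norm_eq, sq_abs]

theorem ae_eq_of_interactionEnergy_eq_zero (hW : IsTame (liftPotential fun p => W p.2) B K)
    (hWn : ∀ x, W x ≤ 0) (hWz : ∀ x, W x = 0 ↔ x = 0) {M : L2I}
    (h : interactionEnergy W M = 0) :
    ∃ x : UnitAddCircle, ∀ᵐ z, ((M z : ℝ) : UnitAddCircle) = x := by
  have hWi := integrable_interaction hW M
  rw [interactionEnergy_eq_integral_prod hW] at h
  have h1 : ∫ p : Label × Label, -W ((M p.1 - M p.2 : ℝ) : UnitAddCircle) ∂(volume.prod volume)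
      = 0 := by
    rw [integral_neg]; linarith
  rw [integral_eq_zero_iff_of_nonneg (fun p => neg_nonneg.2 (hWn _)) hWi.neg] at h1
  have h2 := Measure.ae_ae_of_ae_prod h1
  obtain ⟨z₀, hz₀⟩ := h2.exists
  refine ⟨(M z₀ : ℝ), ?_⟩
  filter_upwards [hz₀] with z hz
  have h3 := (hWz _).1 (neg_eq_zero.1 hz)
  rw [AddCircle.coe_sub, sub_eq_zero] at h3
  exact h3.symm

end Concentration

/-! ### Gluing all particles to one trajectory -/

section Comparison

open Topology

variable {V : UnitAddCircle × UnitAddCircle → ℝ} {W : UnitAddCircle → ℝ} {c B K B' K' : ℝ}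
  {σ v : ℝ → L2I}

theorem exists_competitor (hP : IsTame (potentialEnergy V W) B K) (hK : 0 ≤ K) (hW0 : W 0 = 0)
    {p w : ℝ → ℝ} {a b : ℝ} (hab : a + 2 ≤ b) (hp : HasACDeriv (Icc a b) p w)
    (h2 : IntervalIntegrable (fun t => ‖w t‖ ^ 2) volume a b) (ρ ρ' : L2I) :
    ∃ τ w' : ℝ → L2I, HasACDeriv (Icc a b) τ w' ∧
      IntervalIntegrable (fun t => ‖w' t‖ ^ 2) volume a b ∧
      τ a = cst (p a) + ρ ∧ τ b = cst (p b) + ρ' ∧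
      ∫ t in a..b, vlasovLagrangian V W c t (τ t) (w' t) ≤
        (∫ t in a..b, particleLagrangian V c t (p t : ℝ) (w t))
        + (|p (a + 1) - p a| * ‖ρ‖ + 1 / 2 * ‖ρ‖ ^ 2 + (K + ‖meanForm c‖) * ‖ρ‖)
        + (|p b - p (b - 1)| * ‖ρ'‖ + 1 / 2 * ‖ρ'‖ ^ 2 + (K + ‖meanForm c‖) * ‖ρ'‖) := by
  have hab' : a ≤ b := by linarith
  have hγ := hp.map hab' cst
  have hγ2 : IntervalIntegrable (fun t => ‖cst (w t)‖ ^ 2) volume a b := by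
    simpa [norm_cst] using h2
  have hφ1 : ∀ t ∈ Icc a b, |1 + (-1) * max 0 (min t (a + 1) - a)|
      ≤ (Icc a (a + 1)).indicator (fun _ => (1 : ℝ)) t := by
    intro t ht
    rcases le_total t (a + 1) with h | h
    · rw [indicator_of_mem (show t ∈ Icc a (a + 1) from ⟨ht.1, h⟩), min_eq_left h, max_eq_right (by linarith [ht.1]), abs_le]
      constructor <;> linarith [ht.1]
    · rw [min_eq_right h]
      simp [indicator_nonneg]
  obtain ⟨w₁, h3, h4, h5⟩ := hP.action_perturb_le (meanForm c) hγ hab' hK hγ2 le_rfl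
    (by linarith) (by norm_num : (-1 : ℝ) ^ 2 = 1) (φ₀ := 1) (fun t => rfl) hφ1 ρ
  have hφ2 : ∀ t ∈ Icc a b, |0 + 1 * max 0 (min t (b - 1 + 1) - (b - 1))|
      ≤ (Icc (b - 1) (b - 1 + 1)).indicator (fun _ => (1 : ℝ)) t := by
    intro t ht
    rw [sub_add_cancel, min_eq_left ht.2]
    rcases le_total t (b - 1) with h | h
    · rw [max_eq_left (by linarith)]
      simp [indicator_nonneg]
    · rw [indicator_of_mem (show t ∈ Icc (b - 1) b from ⟨h, ht.2⟩), max_eq_right (by linarith), abs_le]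
      constructor <;> linarith [ht.2]
  obtain ⟨w₂, h6, h7, h8⟩ := hP.action_perturb_le (meanForm c) h3 hab' hK h4
    (by linarith : a ≤ b - 1) (by linarith) (by norm_num : (1 : ℝ) ^ 2 = 1) (φ₀ := 0)
    (fun t => rfl) hφ2 ρ'
  refine ⟨_, w₂, h6, h7, ?_, ?_, ?_⟩
  · rw [min_eq_left (by linarith : a ≤ b - 1 + 1), max_eq_left (by linarith : a - (b - 1) ≤ 0)]
    simp
  · rw [min_eq_right (by linarith : a + 1 ≤ b)]
    simp
  · simp only [vlasovLagrangian_eq_tonelli]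
    refine h8.trans ?_
    -- As b ≥ a + 2, the first ramp has died out before the second starts, so the second cross term
    -- involves only p.
    have e1 : ∀ t, a + 1 ≤ t → (1 + (-1) * max 0 (min t (a + 1) - a)) • ρ = 0 := by
      intro t ht
      rw [min_eq_right ht]; simp
    rw [sub_add_cancel, e1 b (by linarith), e1 (b - 1) (by linarith), add_zero, add_zero]
    simp only [tonelli_cst V hW0, ← map_sub] at h5 ⊢
    have e2 := abs_real_inner_le_norm (cst (p (a + 1) - p a)) ρ
    have e3 := abs_real_inner_le_norm (cst (p b - p (b - 1))) ρ'
    rw [norm_cst] at e2 e3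
    linarith [(abs_le.1 e2).1, (abs_le.1 e3).2]

/-- Recentring at the particle z₀ replaces x by M z₀ and r by r - r z₀; the discrepancy, Z z₀ minus
Z, is integer-valued. -/
theorem ae_recentre_sub_mem_L2Z {M Z r : L2I} {x : ℝ} (hZ : Z ∈ L2Z) (hM : M = cst x + Z + r) :
    ∀ᵐ z₀, cst (M z₀) + (r - cst (r z₀)) - M ∈ L2Z := by
  have hsum : ∀ᵐ z, M z = x + Z z + r z := by
    rw [hM]
    filter_upwards [Lp.coeFn_add (cst x + Z) r, Lp.coeFn_add (cst x) Z, coeFn_cst x] with z e1 e2 e3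
    rw [e1, Pi.add_apply, e2, Pi.add_apply, e3]
  filter_upwards [hsum, hZ] with z₀ h0 ⟨n, hn⟩
  have h1 : cst (M z₀) + (r - cst (r z₀)) - M = cst (n : ℝ) + -Z := by
    rw [h0, hn, map_add, map_add, hM]; abel
  rw [h1, mem_L2Z_iff_coe]
  filter_upwards [coe_add_of_mem_L2Z (cst (n : ℝ)) (neg_mem_L2Z hZ), coeFn_cst (n : ℝ)] with z e1 e2
  rw [e1, e2]
  simp

theorem integrable_cost (D r : L2I) (η C : ℝ) :
    Integrable (fun z => |D z| * (η + |r z|) + 1 / 2 * (η + |r z|) ^ 2 + C * (η + |r z|))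
      volume := by
  have hD := (L2I.integrable D).abs
  have hr := (L2I.integrable r).abs
  have hr2 := L2I.integrable_sq r
  have hDr : Integrable (fun z => |D z| * |r z|) volume :=
    (Lp.memLp D).norm.integrable_mul (Lp.memLp r).norm
  have h := (((hD.const_mul η).add hDr).add
    ((((integrable_const (η ^ 2)).add (hr.const_mul (2 * η))).add hr2).const_mul (1 / 2))).add
    ((((integrable_const η).add hr)).const_mul C)
  refine h.congr (ae_of_all _ fun z => ?_)
  simp only [Pi.add_apply, ← sq_abs (r z)]
  ring

/-- For one particle, |r z| and the displacement |D z| need not be small or bounded; only the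
average over z is O(η). -/
theorem integral_cost_le (D r : L2I) {η C : ℝ} (hη1 : η ≤ 1) (hC : 0 ≤ C) (hr : ‖r‖ ≤ η) :
    ∫ z, (|D z| * (η + |r z|) + 1 / 2 * (η + |r z|) ^ 2 + C * (η + |r z|)) ≤
      (2 * ‖D‖ + 2 + 2 * C) * η := by
  have hD := (L2I.integrable D).abs
  have hra := (L2I.integrable r).abs
  have hr2 := L2I.integrable_sq r
  have hDr : Integrable (fun z => |D z| * |r z|) volume :=
    (Lp.memLp D).norm.integrable_mul (Lp.memLp r).norm
  have hη0 : 0 ≤ η := (norm_nonneg _).trans hr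
  have i1 : Integrable (fun z => η * |D z|) volume := hD.const_mul η
  have i2 : Integrable (fun z => η * |D z| + |D z| * |r z|) volume := i1.add hDr
  have i3 : Integrable (fun z => η * |D z| + |D z| * |r z| + 1 / 2 * η ^ 2) volume :=
    i2.add (integrable_const _)
  have i4 : Integrable (fun z => η * |D z| + |D z| * |r z| + 1 / 2 * η ^ 2 + η * |r z|) volume :=
    i3.add (hra.const_mul η)
  have i5 : Integrable (fun z => η * |D z| + |D z| * |r z| + 1 / 2 * η ^ 2 + η * |r z|
      + 1 / 2 * r z ^ 2) volume := i4.add (hr2.const_mul _)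
  have i6 : Integrable (fun z => η * |D z| + |D z| * |r z| + 1 / 2 * η ^ 2 + η * |r z|
      + 1 / 2 * r z ^ 2 + C * η) volume := i5.add (integrable_const _)
  calc _ = ∫ z, (η * |D z| + |D z| * |r z| + 1 / 2 * η ^ 2 + η * |r z| + 1 / 2 * r z ^ 2
        + C * η + C * |r z|) := by
        refine integral_congr_ae (ae_of_all _ fun z => ?_)
        simp only [← sq_abs (r z)]
        ring
    _ = η * (∫ z, |D z|) + (∫ z, |D z| * |r z|) + 1 / 2 * η ^ 2 + η * (∫ z, |r z|)
        + 1 / 2 * ‖r‖ ^ 2 + C * η + C * (∫ z, |r z|) := by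
        rw [integral_add i6 (hra.const_mul C), integral_add i5 (integrable_const _),
          integral_add i4 (hr2.const_mul _), integral_add i3 (hra.const_mul η),
          integral_add i2 (integrable_const _), integral_add i1 hDr]
        simp only [integral_const_mul, integral_const, probReal_univ, one_smul, L2I.integral_sq]
    _ ≤ _ := by
        have e1 := L2I.integral_abs_le D
        have e2 := L2I.integral_abs_le r
        have e3 := L2I.integral_abs_mul_le D r
        have e4 := mul_le_mul_of_nonneg_left e1 hη0
        have e5 : η * (∫ z, |r z|) ≤ η * η := mul_le_mul_of_nonneg_left (e2.trans hr) hη0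
        have e6 : C * (∫ z, |r z|) ≤ C * η := mul_le_mul_of_nonneg_left (e2.trans hr) hC
        have e7 : ‖D‖ * ‖r‖ ≤ ‖D‖ * η := mul_le_mul_of_nonneg_left hr (norm_nonneg _)
        have e8 : ‖r‖ ^ 2 ≤ η * η := by nlinarith [norm_nonneg r]
        have e9 : η * η ≤ η := mul_le_of_le_one_right hη0 hη1
        nlinarith

/-- Between two times where a minimal curve is close to Dirac masses, its interaction energy is
small. -/
theorem IsVlasovMinimal.interaction_le_of_near (hV : IsTame (liftPotential V) B K) (hK : 0 ≤ K)
    (hW : IsTame (liftPotential fun p => W p.2) B' K') (hK' : 0 ≤ K') (hW0 : W 0 = 0)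
    (hσ : IsVlasovMinimal V W c univ σ v) {D : ℝ} (hD : ∀ a, ‖σ (a + 1) - σ a‖ ≤ D)
    {a b : ℝ} (hab : a + 2 ≤ b) {η : ℝ} (hη1 : η ≤ 1) {x y : ℝ} {Z Z' r r' : L2I}
    (hZ : Z ∈ L2Z) (hZ' : Z' ∈ L2Z) (ha : σ a = cst x + Z + r) (hb : σ b = cst y + Z' + r')
    (hr : ‖r‖ ≤ η) (hr' : ‖r'‖ ≤ η) :
    ∫ t in a..b, -interactionEnergy W (σ t) ≤
      2 * (2 * D + 2 + 2 * (K + K' + ‖meanForm c‖)) * η := by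
  have hP := potentialEnergy_isTame hV hW hK hK'
  have hη0 : 0 ≤ η := (norm_nonneg _).trans hr
  have hab' : a < b := by linarith
  have hσac := hσ.1.mono (subset_univ (Icc a b))
  have h2 := hσ.intervalIntegrable_sq hP hab'
  obtain ⟨f, hf⟩ := exists_isVersion (hσac.intervalIntegrable hab'.le).1.aestronglyMeasurable
  have hf := hf a b subset_rfl
  obtain ⟨hi, he⟩ := hf.integral_fiber_action hσac hab'.le h2 hV c
  set C := K + K' + ‖meanForm c‖ with hC
  have hC0 : 0 ≤ C := by positivity
  set A := ∫ t in a..b, vlasovLagrangian V W c t (σ t) (v t) with hA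
  set D₁ := σ (a + 1) - σ a with hD₁
  set D₂ := σ b - σ (b - 1) with hD₂
  have hD₂D : ‖D₂‖ ≤ D := by
    have := hD (b - 1)
    rwa [sub_add_cancel] at this
  -- For almost every z, σ is compared with the competitor glued to z; the last two lines are the
  -- costs of the two ramps.
  have key : ∀ᵐ z, A ≤ (∫ t in a..b, particleLagrangian V c t
      (fiberPath (σ a) f a z t : ℝ) (f (t, z)))
      + (|D₁ z| * (η + |r z|) + 1 / 2 * (η + |r z|) ^ 2 + C * (η + |r z|))
      + (|D₂ z| * (η + |r' z|) + 1 / 2 * (η + |r' z|) ^ 2 + C * (η + |r' z|)) := by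
    filter_upwards [hf.fiberPath_hasACDeriv hσac hab'.le, hf.fiberPath_sq hab'.le h2,
      hf.fiberPath_ae_eq hσac hab'.le ⟨(by linarith : a ≤ a + 1), by linarith⟩,
      hf.fiberPath_ae_eq hσac hab'.le ⟨hab'.le, le_rfl⟩,
      hf.fiberPath_ae_eq hσac hab'.le ⟨(by linarith : a ≤ b - 1), by linarith⟩,
      ae_recentre_sub_mem_L2Z hZ ha, ae_recentre_sub_mem_L2Z hZ' hb,
      Lp.coeFn_sub (σ (a + 1)) (σ a), Lp.coeFn_sub (σ b) (σ (b - 1))]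
      with z e1 e2 e3 e4 e5 e6 e7 e8 e9
    have e0 : fiberPath (σ a) f a z a = σ a z := by simp [fiberPath]
    obtain ⟨τ, w', t1, t2, t3, t4, t5⟩ := exists_competitor (c := c) hP (add_nonneg hK hK') hW0
      hab e1 e2 (r - cst (r z)) (r' - cst (r' z))
    have h3 := hσ.integral_le hP hab' t1 t2 (by rw [t3, e0]; exact e6) (by rw [t4, e4]; exact e7)
    rw [e0, e3, e4, e5] at t5
    have n1 : ‖r - cst (r z)‖ ≤ η + |r z| :=
      (norm_sub_le _ _).trans (add_le_add hr (norm_cst _).le)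
    have n2 : ‖r' - cst (r' z)‖ ≤ η + |r' z| :=
      (norm_sub_le _ _).trans (add_le_add hr' (norm_cst _).le)
    have m1 : D₁ z = σ (a + 1) z - σ a z := e8
    have m2 : D₂ z = σ b z - σ (b - 1) z := e9
    rw [m1, m2]
    refine (h3.trans t5).trans ?_
    gcongr
  have hcost1 := integrable_cost D₁ r η C
  have hcost2 := integrable_cost D₂ r' η C
  have h3 : A ≤ (∫ z, ∫ t in a..b, particleLagrangian V c t
      (fiberPath (σ a) f a z t : ℝ) (f (t, z)))
      + (∫ z, (|D₁ z| * (η + |r z|) + 1 / 2 * (η + |r z|) ^ 2 + C * (η + |r z|)))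
      + ∫ z, (|D₂ z| * (η + |r' z|) + 1 / 2 * (η + |r' z|) ^ 2 + C * (η + |r' z|)) := by
    have h4 := integral_mono_ae (integrable_const A) ((hi.add hcost1).add hcost2) key
    rw [integral_const, probReal_univ, one_smul] at h4
    refine h4.trans_eq ?_
    have q1 := integral_add (hi.add hcost1) hcost2
    have q2 := integral_add hi hcost1
    simp only [Pi.add_apply] at q1 q2 ⊢
    rw [q1, q2]
  have hWi : IntervalIntegrable (fun t => interactionEnergy W (σ t)) volume a b :=
    ((continuous_interactionEnergy hW hK').comp hσ.1.continuous).intervalIntegrable _ _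
  have h5 : ∫ t in a..b, (1 / 2 * ‖v t‖ ^ 2 - externalEnergy V t (σ t) - ∫ z, c * v t z)
      = A + ∫ t in a..b, interactionEnergy W (σ t) := by
    rw [hA, ← intervalIntegral.integral_add (hσ.intervalIntegrable hP hab') hWi]
    refine intervalIntegral.integral_congr fun t _ => ?_
    simp only [vlasovLagrangian]
    ring
  have h6 := integral_cost_le D₁ r hη1 hC0 hr
  have h7 := integral_cost_le D₂ r' hη1 hC0 hr'
  have h8 : (2 * ‖D₁‖ + 2 + 2 * C) * η ≤ (2 * D + 2 + 2 * C) * η := by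
    gcongr; exact hD a
  have h9 : (2 * ‖D₂‖ + 2 + 2 * C) * η ≤ (2 * D + 2 + 2 * C) * η := by
    gcongr
  -- The mean particle action is A + ∫ 𝓦, so A cancels and only the ramp costs bound ∫ -𝓦.
  rw [he, h5] at h3
  rw [intervalIntegral.integral_neg]
  linarith

/-- Along a minimal curve of bounded action, the interaction energy vanishes. -/
theorem IsVlasovMinimal.interactionEnergy_eq_zero (hV : IsTame (liftPotential V) B K)
    (hK : 0 ≤ K) (hW : IsTame (liftPotential fun p => W p.2) B' K') (hK' : 0 ≤ K')
    (hWn : ∀ x, W x ≤ 0) (hWz : ∀ x, W x = 0 ↔ x = 0) (hσ : IsVlasovMinimal V W c univ σ v)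
    (hlim : liminf (fun k : ℕ => extIntegral (fun t => vlasovLagrangian V W c t (σ t) (v t)
        + criticalValue V W c) (-(k : ℝ)) (k : ℝ)) atTop < ⊤) (t : ℝ) :
    interactionEnergy W (σ t) = 0 := by
  have hP := potentialEnergy_isTame hV hW hK hK'
  have hW0 : W 0 = 0 := (hWz 0).2 rfl
  obtain ⟨R, hR⟩ := hσ.exists_interaction_bound hV hK hW hK' hWn hW0 hlim
  obtain ⟨D, hD0, hD⟩ := hσ.exists_displacement_bound hP
  set g : ℝ → ℝ := fun t => -interactionEnergy W (σ t) with hg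
  have hgc : Continuous g := ((continuous_interactionEnergy hW hK').comp hσ.1.continuous).neg
  have hg0 : ∀ t, 0 ≤ g t := fun t => neg_nonneg.2 (interactionEnergy_nonpos hWn _)
  have hR' : ∀ k : ℕ, ∫ t in (-(k : ℝ))..k, g (-t) ≤ R := by
    intro k
    rw [intervalIntegral.integral_comp_neg, neg_neg]
    exact hR k
  set C := 2 * (2 * D + 2 + 2 * (K + K' + ‖meanForm c‖)) with hC
  have hC0 : 0 < C := by positivity
  -- T ≥ 1 ensures that times -a ≤ -T and b ≥ T are at least 2 apart, leaving room for both ramps.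
  set T := |t| + 1 with hT
  have hT1 : 1 ≤ T := by linarith [abs_nonneg t]
  have hint : ∫ s in (-T)..T, g s ≤ 0 := by
    refine le_of_forall_pos_le_add fun ε hε => ?_
    set η := min 1 (ε / C) with hη
    have hηpos : 0 < η := by positivity
    obtain ⟨δ, hδ, hnear⟩ := exists_near_const_of_interaction_small hW hWn hWz hηpos
    obtain ⟨b, hb, hgb⟩ := exists_small_of_integral_bounded hgc hg0 hR hδ T
    obtain ⟨a, ha, hga⟩ := exists_small_of_integral_bounded (g := fun t => g (-t))
      (hgc.comp continuous_neg) (fun t => hg0 _) hR' hδ T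
    obtain ⟨x, Z, r, hZ, e1, hr⟩ := hnear _ hga
    obtain ⟨y, Z', r', hZ', e2, hr'⟩ := hnear _ hgb
    have h1 := hσ.interaction_le_of_near hV hK hW hK' hW0 hD (by linarith : -a + 2 ≤ b)
      (min_le_left _ _) hZ hZ' e1 e2 hr hr'
    have h2 : ∫ s in (-T)..T, g s ≤ ∫ s in (-a)..b, g s :=
      intervalIntegral.integral_mono_interval (by linarith) (by linarith) hb (ae_of_all _ hg0)
        (hgc.intervalIntegrable _ _)
    have h3 : C * η ≤ ε := by
      calc C * η ≤ C * (ε / C) := mul_le_mul_of_nonneg_left (min_le_right _ _) hC0.le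
        _ = ε := by field_simp
    linarith
  by_contra hne
  have hpos : 0 < g t := lt_of_le_of_ne (hg0 t) fun h => hne (neg_eq_zero.1 h.symm)
  have := intervalIntegral.integral_pos (by linarith : -T < T) hgc.continuousOn
    (fun s _ => hg0 s) ⟨t, ⟨by linarith [neg_abs_le t], by linarith [le_abs_self t]⟩, hpos⟩
  linarith

end Comparison

/-! ### The motion of the Dirac masses -/

section Dirac

open Topology

theorem map_eq_dirac {M : L2I} {x : UnitAddCircle} (h : ∀ᵐ z, ((M z : ℝ) : UnitAddCircle) = x) :
    Measure.map (fun z : Label => ((M z : ℝ) : UnitAddCircle)) volume = Measure.dirac x := by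
  rw [Measure.map_congr h, Measure.map_const]
  simp

theorem norm_sub_le_of_ae_coe {M N : L2I} {x y : UnitAddCircle}
    (hx : ∀ᵐ z, ((M z : ℝ) : UnitAddCircle) = x) (hy : ∀ᵐ z, ((N z : ℝ) : UnitAddCircle) = y) :
    ‖x - y‖ ≤ ‖M - N‖ := by
  refine le_trans ?_ (L2I.integral_abs_le (M - N))
  calc ‖x - y‖ = ∫ _ : Label, ‖x - y‖ := by simp
    _ ≤ _ := by
      refine integral_mono_ae (integrable_const _) (L2I.integrable _).abs ?_
      filter_upwards [hx, hy, Lp.coeFn_sub M N] with z h1 h2 h3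
      rw [h3, Pi.sub_apply, ← h1, ← h2, ← AddCircle.coe_sub, UnitAddCircle.norm_eq]
      simpa using round_le (M z - N z) 0

theorem eq_of_continuous_of_coe_eq_zero {d : ℝ → ℝ} (hd : Continuous d)
    (h : ∀ t, (d t : UnitAddCircle) = 0) (s t : ℝ) : d s = d t := by
  have : DiscreteTopology (range ((↑) : ℤ → ℝ)) :=
    Int.isClosedEmbedding_coe_real.isEmbedding.toHomeomorph.symm.isEmbedding.discreteTopology
  refine isPreconnected_univ.constant_of_mapsTo (T := range ((↑) : ℤ → ℝ)) ⟨this⟩ hd.continuousOn ?_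
    (mem_univ s) (mem_univ t)
  intro r _
  obtain ⟨n, hn⟩ := coe_eq_coe_iff.1 ((h r).trans (AddCircle.coe_zero 1).symm)
  exact ⟨n, by rw [← hn, sub_zero]⟩

theorem hasACDeriv_univ_of {E : Type*} [NormedAddCommGroup E] [NormedSpace ℝ E] [CompleteSpace E]
    {u v : ℝ → E} (hv : LocallyIntegrable v volume) (h : ∀ t, u t = u 0 + ∫ r in (0 : ℝ)..t, v r) :
    HasACDeriv univ u v := by
  refine ⟨hv.locallyIntegrableOn _, fun s _ t _ => ?_⟩
  have hi : ∀ a b : ℝ, IntervalIntegrable v volume a b := fun a b =>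
    (hv.integrableOn_isCompact isCompact_uIcc).intervalIntegrable
  rw [h s, h t, ← intervalIntegral.integral_interval_sub_left (hi 0 t) (hi 0 s)]
  abel

/-- Lebesgue differentiation recovers the velocity from the curve almost everywhere. -/
theorem HasACDeriv.ae_eq_of_sub_const {u v u' v' : ℝ → ℝ} (h : HasACDeriv univ u v)
    (h' : HasACDeriv univ u' v') (hc : ∀ s t, u s - u' s = u t - u' t) : v =ᵐ[volume] v' := by
  filter_upwards [LocallyIntegrable.ae_hasDerivAt_integral (locallyIntegrableOn_univ.1 h.1),
    LocallyIntegrable.ae_hasDerivAt_integral (locallyIntegrableOn_univ.1 h'.1)] with t h1 h2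
  refine (h1 0).unique ?_
  refine (h2 0).congr_of_eventuallyEq (Eventually.of_forall fun s => ?_)
  simp only
  rw [← h.2 0 trivial s trivial, ← h'.2 0 trivial s trivial]
  linarith [hc s 0]

theorem extIntegral_congr {f g : ℝ → ℝ} {a b : ℝ} (hab : a ≤ b) (h : ∀ t ∈ Icc a b, f t = g t) :
    extIntegral f a b = extIntegral g a b := by
  have h1 : EqOn f g (uIoc a b) := fun t ht => h t (by
    rw [uIoc_of_le hab] at ht; exact Ioc_subset_Icc_self ht)
  rw [extIntegral, extIntegral, intervalIntegrable_congr h1]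
  congr 2
  exact intervalIntegral.integral_congr fun t ht => h t (by rwa [uIcc_of_le hab] at ht)

variable {V : UnitAddCircle × UnitAddCircle → ℝ} {W : UnitAddCircle → ℝ} {c B K B' K' : ℝ}
  {σ v : ℝ → L2I}

/-- If a minimal curve consists of Dirac masses, then these move along a minimal curve of the
particle Lagrangian. -/
theorem IsVlasovMinimal.isParticleMinimal (hV : IsTame (liftPotential V) B K) (hK : 0 ≤ K)
    (hW : IsTame (liftPotential fun p => W p.2) B' K') (hK' : 0 ≤ K') (hW0 : W 0 = 0)
    (hσ : IsVlasovMinimal V W c univ σ v) (hzero : ∀ t, interactionEnergy W (σ t) = 0)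
    {q : ℝ → UnitAddCircle} (hq : ∀ t, ∀ᵐ z, ((σ t z : ℝ) : UnitAddCircle) = q t) :
    IsParticleMinimal V c univ q := by
  have hP := potentialEnergy_isTame hV hW hK hK'
  have hqc : Continuous q := by
    rw [Metric.continuous_iff]
    intro t ε hε
    obtain ⟨δ, hδ, h⟩ := Metric.continuous_iff.1 hσ.1.continuous t ε hε
    refine ⟨δ, hδ, fun s hs => ?_⟩
    have := h s hs
    rw [dist_eq_norm] at this ⊢
    exact (norm_sub_le_of_ae_coe (hq s) (hq t)).trans_lt this
  obtain ⟨f, hf⟩ := exists_isVersion (S := univ) (v := v) (by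
    rw [Measure.restrict_univ]
    exact (locallyIntegrableOn_univ.1 hσ.1.1).aestronglyMeasurable)
  have hf : ∀ a b, IsVersion a b v f := fun a b => hf a b (subset_univ _)
  have hac : ∀ a b : ℝ, HasACDeriv (Icc a b) σ v := fun a b => hσ.1.mono (subset_univ _)
  set p : Label → ℝ → ℝ := fun z t => σ 0 z + ∫ s in (0 : ℝ)..t, f (s, z) with hp
  have hpt : ∀ t, ∀ᵐ z, p z t = σ t z := by
    intro t
    rcases le_total 0 t with h | h
    · exact (hf 0 t).fiberPath_ae_eq (hac 0 t) h (right_mem_Icc.2 h)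
    · filter_upwards [(hf t 0).fiberPath_ae_eq (hac t 0) h (right_mem_Icc.2 h)] with z hz
      simp only [hp, ← hz, fiberPath]
      rw [intervalIntegral.integral_symm 0 t]
      ring
  have hsq : ∀ᵐ z, ∀ n : ℕ, IntervalIntegrable (fun t => ‖f (t, z)‖ ^ 2) volume (-(n + 1 : ℝ))
      (n + 1) := by
    rw [ae_all_iff]
    intro n
    have hn : -(n + 1 : ℝ) < n + 1 := by linarith [(n.cast_nonneg : (0 : ℝ) ≤ n)]
    exact (hf _ _).fiberPath_sq hn.le (hσ.intervalIntegrable_sq hP hn)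
  have hsq' : ∀ᵐ z, ∀ a b : ℝ, a ≤ b →
      IntervalIntegrable (fun t => ‖f (t, z)‖ ^ 2) volume a b := by
    filter_upwards [hsq] with z hz a b hab
    obtain ⟨n, hn⟩ := exists_nat_ge (max |a| |b|)
    have h1 := (le_max_left _ _).trans hn
    have h2 := (le_max_right _ _).trans hn
    refine (hz n).mono_set ?_
    rw [uIcc_of_le hab, uIcc_of_le (by linarith [(n.cast_nonneg : (0 : ℝ) ≤ n)])]
    exact Icc_subset_Icc (by linarith [neg_abs_le a]) (by linarith [le_abs_self b])
  have hloc : ∀ᵐ z, LocallyIntegrable (fun t => f (t, z)) volume := by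
    filter_upwards [hsq'] with z hz
    have hm : Measurable fun t => f (t, z) :=
      (hf 0 0).measurable.comp (measurable_id.prodMk measurable_const)
    intro t
    refine ⟨Icc (t - 1) (t + 1), Icc_mem_nhds (by linarith) (by linarith), ?_⟩
    have h1 := hz (t - 1) (t + 1) (by linarith)
    rw [intervalIntegrable_iff_integrableOn_Icc_of_le (by linarith)] at h1
    refine Integrable.mono' (h1.add (integrable_const (1 : ℝ))) hm.aestronglyMeasurable
      (ae_of_all _ fun s => ?_)
    simp only [Pi.add_apply]
    -- Local square integrability, with ‖f‖ ≤ ‖f‖² + 1, gives local integrability of the velocity.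
    nlinarith [sq_nonneg (‖f (s, z)‖ - 1), norm_nonneg (f (s, z))]
  have hpac : ∀ᵐ z, HasACDeriv univ (p z) (fun t => f (t, z)) := by
    filter_upwards [hloc] with z hz
    exact hasACDeriv_univ_of hz fun t => by simp [hp]
  have hpq : ∀ᵐ z, ∀ t, ((p z t : ℝ) : UnitAddCircle) = q t := by
    -- The exceptional null set depends on t, so rational times come first; continuity of both sides
    -- gives the rest.
    have h1 : ∀ᵐ z, ∀ t : ℚ, ((p z t : ℝ) : UnitAddCircle) = q t := by
      rw [ae_all_iff]
      intro t
      filter_upwards [hpt t, hq t] with z h1 h2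
      rw [h1, h2]
    filter_upwards [h1, hpac] with z hz hz2
    have h3 : Continuous fun t => ((p z t : ℝ) : UnitAddCircle) :=
      (AddCircle.continuous_mk' 1).comp hz2.continuous
    exact fun t => congrFun (Rat.denseRange_cast.equalizer h3 hqc (funext hz)) t
  obtain ⟨z₀, hz₀ac, hz₀q, hz₀sq⟩ := (hpac.and (hpq.and hsq')).exists
  -- Two lifts of q differ by a continuous integer-valued function, hence by a constant, so their
  -- velocities agree.
  have hf₀ : ∀ᵐ z, (fun t => f (t, z)) =ᵐ[volume] fun t => f (t, z₀) := by
    filter_upwards [hpac, hpq] with z h1 h2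
    refine h1.ae_eq_of_sub_const hz₀ac fun s t => ?_
    refine eq_of_continuous_of_coe_eq_zero (d := fun t => p z t - p z₀ t)
      (h1.continuous.sub hz₀ac.continuous) (fun t => ?_) s t
    rw [AddCircle.coe_sub, h2, hz₀q, sub_self]
  have haction : ∀ a b : ℝ, a < b → ∫ t in a..b, vlasovLagrangian V W c t (σ t) (v t)
      = ∫ t in a..b, particleLagrangian V c t (q t) (f (t, z₀)) := by
    intro a b hab
    obtain ⟨-, he⟩ := (hf a b).integral_fiber_action (hac a b) hab.le
      (hσ.intervalIntegrable_sq hP hab) hV c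
    have h1 : ∫ t in a..b, vlasovLagrangian V W c t (σ t) (v t)
        = ∫ t in a..b, (1 / 2 * ‖v t‖ ^ 2 - externalEnergy V t (σ t) - ∫ z, c * v t z) := by
      refine intervalIntegral.integral_congr fun t _ => ?_
      simp only [vlasovLagrangian, hzero, sub_zero]
    rw [h1, ← he]
    have h2 : ∀ᵐ z, ∫ t in a..b, particleLagrangian V c t
        (fiberPath (σ a) f a z t : ℝ) (f (t, z))
        = ∫ t in a..b, particleLagrangian V c t (q t) (f (t, z₀)) := by
      filter_upwards [hpt a, hpq, hpac, hf₀] with z e1 e2 e3 e4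
      refine intervalIntegral.integral_congr_ae ?_
      filter_upwards [e4] with t ht _
      have h3 : fiberPath (σ a) f a z t = p z t := by
        rw [fiberPath, ← e1, ← e3.2 a trivial t trivial]; ring
      rw [h3, e2, ht]
    rw [integral_congr_ae h2]
    simp
  refine ⟨fun t => f (t, z₀), ⟨p z₀, hz₀ac, fun t _ => hz₀q t⟩, ?_⟩
  rintro t₀ t₁ ht - r s ⟨R, hR, hRr⟩ hr0 hr1
  have hm0 := left_mem_Icc.2 ht.le
  have hm1 := right_mem_Icc.2 ht.le
  have hi : IntervalIntegrable (fun t => particleLagrangian V c t (q t) (f (t, z₀))) volume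
      t₀ t₁ := by
    simp only [← hz₀q, particleLagrangian_eq_tonelli]
    exact (hV.intervalIntegrable_tonelli_iff _ (hz₀ac.mono (subset_univ _)) ht.le).2
      (hz₀sq _ _ ht.le)
  rw [extIntegral_of_intervalIntegrable hi, ← haction t₀ t₁ ht, extIntegral_congr ht.le
    (g := fun t => particleLagrangian V c t (R t : ℝ) (s t)) fun t h => by rw [hRr t h]]
  by_cases hri : IntervalIntegrable (fun t => particleLagrangian V c t (R t : ℝ) (s t)) volume t₀ t₁
  · rw [extIntegral_of_intervalIntegrable hri, EReal.coe_le_coe_iff]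
    have hs2 := hri
    simp only [particleLagrangian_eq_tonelli] at hs2
    rw [hV.intervalIntegrable_tonelli_iff _ hR ht.le] at hs2
    have hend : ∀ t ∈ Icc t₀ t₁, r t = q t → cst (R t) - σ t ∈ L2Z := by
      intro t h hrq
      rw [sub_mem_L2Z_iff]
      filter_upwards [coeFn_cst (R t), hq t] with z e1 e2
      rw [e1, e2, hRr t h, hrq]
    -- Endpoints that agree on the circle differ from those of σ by integer-valued functions, as
    -- minimality in L²(I) allows.
    have := hσ.integral_le hP ht (hR.map ht.le cst) (by simpa [norm_cst] using hs2)
      (hend _ hm0 hr0) (hend _ hm1 hr1)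
    refine this.trans_eq (intervalIntegral.integral_congr fun t _ => ?_)
    simp only [vlasovLagrangian_eq_tonelli, tonelli_cst V hW0]
  · rw [extIntegral_of_not hri]; exact le_top

end Dirac

end VlasovCircle

set_option linter.unusedVariables false in
theorem lemma2p13
    (V : UnitAddCircle × UnitAddCircle → ℝ)
    (hV : ContDiff ℝ 2 (fun x : ℝ × ℝ => V ((x.1 : UnitAddCircle), (x.2 : UnitAddCircle))))
    (W : UnitAddCircle → ℝ)
    (hW : ContDiff ℝ 2 (fun x : ℝ => W (x : UnitAddCircle)))
    (hW_even : ∀ x, W (-x) = W x)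
    (hW_nonpos : ∀ x, W x ≤ 0)
    (hW_zero : ∀ x, W x = 0 ↔ x = 0)
    (hW_second : iteratedDeriv 2 (fun x : ℝ => W (x : UnitAddCircle)) 0 < 0)
    (c : ℝ) (σ v : ℝ → VlasovCircle.L2I)
    (hσ : VlasovCircle.IsVlasovMinimal V W c univ σ v)
    (hmon : ∀ t : ℝ, ∃ M ∈ VlasovCircle.Mon, σ t - M ∈ VlasovCircle.L2Z)
    (hlim : liminf (fun k : ℕ => VlasovCircle.extIntegral
      (fun t => VlasovCircle.vlasovLagrangian V W c t (σ t) (v t)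
        + VlasovCircle.criticalValue V W c) (-(k : ℝ)) (k : ℝ)) atTop < ⊤) :
    ∃ q : ℝ → UnitAddCircle,
      VlasovCircle.IsParticleMinimal V c univ q ∧
        ∀ t : ℝ, Measure.map (fun x : VlasovCircle.Label => ((σ t x : ℝ) : UnitAddCircle)) volume
          = Measure.dirac (q t) := by
  obtain ⟨B, K, -, hK, hVt⟩ := VlasovCircle.exists_isTame hV
  obtain ⟨B', K', -, hK', hWt⟩ := VlasovCircle.exists_isTame (V := fun p => W p.2)
    (hW.comp contDiff_snd)
  have hzero := hσ.interactionEnergy_eq_zero hVt hK hWt hK' hW_nonpos hW_zero hlim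
  choose q hq using fun t =>
    VlasovCircle.ae_eq_of_interactionEnergy_eq_zero hWt hW_nonpos hW_zero (hzero t)
  exact ⟨q, hσ.isParticleMinimal hVt hK hWt hK' ((hW_zero 0).2 rfl) hzero hq,
    fun t => VlasovCircle.map_eq_dirac (hq t)⟩
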